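/- Let $\mathsf H_1,\dots,\mathsf H_m$ be separable real Hilbert spaces, let $\mathbf H=\mathsf H_1\oplus\cdots\oplus\mathsf H_m$ be their direct Hilbert sum, and let $(\Omega,\mathcal F,\mathsf P)$ be a probability space. For every $i\in\{1,\dots,m\}$ let $\mathsf A_i\colon\mathsf H_i\to2^{\mathsf H_i}$ be maximally monotone, let $\mathbf B\colon\mathbf H\to2^{\mathbf H}$ be maximally monotone, and write $\mathbf A\mathbf x=\mathsf A_1\mathsf x_1\times\cdots\times\mathsf A_m\mathsf x_m$. For a set-valued operator $\mathsf M$, let $\mathsf M^{-1}$ be its inverse ($\mathsf x\in\mathsf M^{-1}\mathsf u\Leftrightarrow\mathsf u\in\mathsf M\mathsf x$) and $\mathsf J_{\mathsf M}=(\mathrm{Id}+\mathsf M)^{-1}$ its resolvent, which is an everywhere defined single-valued map when $\mathsf M$ is maximally monotone. Let $$\mathbf F=\{\mathbf x\in\mathbf H:\ \mathbf 0\in\mathbf A\mathbf x+\mathbf B\mathbf x\},\qquad \mathbf F^*=\{\mathbf u\in\mathbf H:\ \mathbf 0\in-\mathbf A^{-1}(-\mathbf u)+\mathbf B^{-1}\mathbf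 u\}$$ be the sets of primal and of dual solutions, and suppose that $\mathbf F\neq\varnothing$. (If $\mathbf B\mathbf x=\mathsf B_1\mathbf x\times\cdots\times\mathsf B_m\mathbf x$ for all $\mathbf x$, then $\mathbf x\in\mathbf F$ means $0\in\mathsf A_i\mathsf x_i+\mathsf B_i\mathbf x$ for every $i$; if $\mathbf B^{-1}\mathbf u=\mathsf C_1\mathbf u\times\cdots\times\mathsf C_m\mathbf u$ for all $\mathbf u$, then $\mathbf u\in\mathbf F^*$ means $0\in-\mathsf A_i^{-1}(-\mathsf u_i)+\mathsf C_i\mathbf u$ for every $i$.) Let $\gamma>0$, let $(\mu_n)_{n\in\mathbb N}$ be a sequence in $]0,2[$ with $\inf_n\mu_n>0$ and $\sup_n\mu_n<2$, let $\mathbf x_0,\mathbf z_0,(\mathbf a_n)_{n\in\mathbb N},(\mathbf b_n)_{n\in\mathbb N}$ be $\mathbf H$-valued random variables, and let $(\boldsymbol\varepsilon_n)_{n\in\mathbb N}$ be identically distributed random variables with values in $\{0,1\}^m\smallsetminus\{\mathbf 0\}$. Write $\mathsf J_{\gamma\mathbf B}\mathbf x=(\mathsf Q_i\mathbf x)_{1\le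 i\le m}$ and iterate, for $n=0,1,\dots$ and $i=1,\dots,m$, $$z_{i,n+1}=z_{i,n}+\varepsilon_{i,n}\big(\mathsf Q_i\mathbf x_n+b_{i,n}-z_{i,n}\big),$$ $$x_{i,n+1}=x_{i,n}+\varepsilon_{i,n}\mu_n\big(\mathsf J_{\gamma\mathsf A_i}(2z_{i,n+1}-x_{i,n})+a_{i,n}-z_{i,n+1}\big).$$ Set $\mathcal X_n=\sigma(\mathbf x_0,\dots,\mathbf x_n)$ and assume that: 1. $\sum_n\sqrt{\mathsf E(\|\mathbf a_n\|^2\,|\,\mathcal X_n)}<+\infty$ and $\sum_n\sqrt{\mathsf E(\|\mathbf b_n\|^2\,|\,\mathcal X_n)}<+\infty$ almost surely; 2. for every $n$, $\sigma(\boldsymbol\varepsilon_n)$ and $\mathcal X_n$ are independent; 3. $\mathsf P[\varepsilon_{i,0}=1]>0$ for every $i\in\{1,\dots,m\}$. Then $(\mathbf x_n)$ converges weakly almost surely to an $\mathbf H$-valued random variable $\mathbf x$ such that $\mathbf z=\mathsf J_{\gamma\mathbf B}\mathbf x$ is an $\mathbf F$-valued random variable and $\mathbf u=\gamma^{-1}(\mathbf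 x-\mathbf z)$ is an $\mathbf F^*$-valued random variable. Furthermore, if the random variables $(\boldsymbol\varepsilon_n)_{n\in\mathbb N}$ are mutually independent, $\mathsf J_{\gamma\mathbf B}$ is weakly sequentially continuous, and $\mathbf b_n\rightharpoonup\mathbf 0$ almost surely, then, almost surely, $\mathbf z_n\rightharpoonup\mathbf z$ and $\gamma^{-1}(\mathbf x_n-\mathbf z_n)\rightharpoonup\mathbf u$. -/

import Mathlib

open MeasureTheory ProbabilityTheory Filter Topology
open scoped ENNReal Pointwise

namespace BlockDR

set_option linter.unusedSectionVars false

section Operators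

variable {E : Type*} [NormedAddCommGroup E] [InnerProductSpace ℝ E]

/-- A set-valued operator `A : E → 2^E` is monotone. -/
def IsMonotone (A : E → Set E) : Prop :=
  ∀ x y u v : E, u ∈ A x → v ∈ A y → 0 ≤ inner ℝ (x - y) (u - v)

/-- A monotone operator is maximally monotone if its graph is not properly contained in the graph
of another monotone operator. -/
def IsMaximallyMonotone (A : E → Set E) : Prop :=
  IsMonotone A ∧ ∀ A' : E → Set E, IsMonotone A' → (∀ x, A x ⊆ A' x) → ∀ x, A' x ⊆ A x

/-- The inverse of a set-valued operator: `x ∈ A⁻¹ u ↔ u ∈ A x`. -/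
def inverseOp {α β : Type*} (A : α → Set β) (u : β) : Set α := {x | u ∈ A x}

/-- The set-valued resolvent `(Id + A)⁻¹`. -/
def setResolvent (A : E → Set E) : E → Set E := inverseOp (fun p => {p} + A p)

open Classical in
/-- The resolvent `J_A = (Id + A)⁻¹` as a single-valued map; `resolventMap A x` is an element of
`(Id + A)⁻¹ x` whenever this set is nonempty. If `A` is monotone, that set has at most one
element. -/
noncomputable def resolventMap (A : E → Set E) (x : E) : E :=
  if h : (setResolvent A x).Nonempty then h.choose else 0

/-- `(x n)` converges weakly to `l`: convergence in the weak topology of `E`. -/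
def WeaklyTendsto (x : ℕ → E) (l : E) : Prop :=
  Tendsto (fun n => toWeakSpace ℝ E (x n)) atTop (𝓝 (toWeakSpace ℝ E l))

/-- `T` maps every weakly convergent sequence to a sequence converging weakly to the image of the
limit. -/
def IsWeaklySeqContinuous (T : E → E) : Prop :=
  ∀ (x : ℕ → E) (l : E), WeaklyTendsto x l → WeaklyTendsto (fun n => T (x n)) (T l)

theorem mem_setResolvent {A : E → Set E} {x p : E} : p ∈ setResolvent A x ↔ x - p ∈ A p := by
  simp only [setResolvent, inverseOp, Set.mem_ofPred_eq, Set.singleton_add, Set.mem_image]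
  constructor
  · rintro ⟨v, hv, rfl⟩
    simpa using hv
  · intro h
    exact ⟨x - p, h, by simp⟩

theorem resolventMap_eq_of_mem {A : E → Set E} (hA : IsMonotone A) {x p : E}
    (hp : p ∈ setResolvent A x) : resolventMap A x = p := by
  have h : (setResolvent A x).Nonempty := ⟨p, hp⟩
  have hq : resolventMap A x ∈ setResolvent A x := by
    simp only [resolventMap, dif_pos h]
    exact h.choose_spec
  have key := hA _ _ _ _ (mem_setResolvent.1 hq) (mem_setResolvent.1 hp)
  have e : x - resolventMap A x - (x - p) = -(resolventMap A x - p) := by abel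
  rw [e, inner_neg_right] at key
  have h0 : inner ℝ (resolventMap A x - p) (resolventMap A x - p) ≤ (0 : ℝ) := by linarith
  exact sub_eq_zero.1 (inner_self_eq_zero (𝕜 := ℝ)|>.1 (le_antisymm h0 real_inner_self_nonneg))

theorem weaklyTendsto_iff_inner [CompleteSpace E] (x : ℕ → E) (l : E) :
    WeaklyTendsto x l ↔
      ∀ v : E, Tendsto (fun n => (inner ℝ v (x n) : ℝ)) atTop (𝓝 (inner ℝ v l)) := by
  have h : WeaklyTendsto x l ↔
      ∀ f : StrongDual ℝ E, Tendsto (fun n => f (x n)) atTop (𝓝 (f l)) := by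
    refine WeakBilin.tendsto_iff_forall_eval_tendsto (topDualPairing ℝ E).flip ?_
    intro y y' hyy
    refine ext_inner_left ℝ fun v => ?_
    simpa using LinearMap.congr_fun hyy (InnerProductSpace.toDual ℝ E v)
  rw [h]
  constructor
  · intro hf v
    simpa using hf (InnerProductSpace.toDual ℝ E v)
  · intro hv f
    simpa [InnerProductSpace.toDual_symm_apply] using hv ((InnerProductSpace.toDual ℝ E).symm f)

end Operators

section Blocks

variable {m : ℕ} {H : Fin m → Type*} [∀ i, NormedAddCommGroup (H i)]
  [∀ i, InnerProductSpace ℝ (H i)]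

/-- The operator `x ↦ A₁ x₁ × ⋯ × Aₘ xₘ` on the direct Hilbert sum. -/
def blockOp (A : ∀ i, H i → Set (H i)) (x : PiLp 2 H) : Set (PiLp 2 H) :=
  {y | ∀ i, y i ∈ A i (x i)}

/-- The operator `x ↦ B₁ x × ⋯ × Bₘ x` built from operators `Bᵢ` from the direct Hilbert sum to
its `i`-th summand. -/
def prodOp (B : ∀ i, PiLp 2 H → Set (H i)) (x : PiLp 2 H) : Set (PiLp 2 H) :=
  {y | ∀ i, y i ∈ B i x}

/-- Primal solutions: `0 ∈ (A₁ x₁ × ⋯ × Aₘ xₘ) + B x`. -/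
def primalSolutions (A : ∀ i, H i → Set (H i)) (B : PiLp 2 H → Set (PiLp 2 H)) :
    Set (PiLp 2 H) :=
  {x | 0 ∈ blockOp A x + B x}

/-- Dual solutions: `0 ∈ -(A₁⁻¹ (-u₁) × ⋯ × Aₘ⁻¹ (-uₘ)) + B⁻¹ u`. -/
def dualSolutions (A : ∀ i, H i → Set (H i)) (B : PiLp 2 H → Set (PiLp 2 H)) :
    Set (PiLp 2 H) :=
  {u | 0 ∈ -(blockOp (fun i => inverseOp (A i)) (-u)) + inverseOp B u}

/-- If `B x = B₁ x × ⋯ × Bₘ x`, the primal problem reads `0 ∈ Aᵢ xᵢ + Bᵢ x` for every `i`. -/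
theorem mem_primalSolutions_prodOp (A : ∀ i, H i → Set (H i))
    (B : ∀ i, PiLp 2 H → Set (H i)) (x : PiLp 2 H) :
    x ∈ primalSolutions A (prodOp B) ↔ ∀ i, (0 : H i) ∈ A i (x i) + B i x := by
  simp only [primalSolutions, Set.mem_ofPred_eq, Set.mem_add]
  constructor
  · rintro ⟨a, ha, b, hb, hab⟩ i
    exact ⟨a i, ha i, b i, hb i, by simpa using congrArg (fun y : PiLp 2 H => y i) hab⟩
  · intro h
    choose a ha b hb hab using h
    exact ⟨WithLp.toLp 2 a, ha, WithLp.toLp 2 b, hb, by ext i; simpa using hab i⟩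

/-- If `B⁻¹ u = C₁ u × ⋯ × Cₘ u`, the dual problem reads `0 ∈ -Aᵢ⁻¹ (-uᵢ) + Cᵢ u` for
every `i`. -/
theorem mem_dualSolutions_of_inverseOp_eq (A : ∀ i, H i → Set (H i))
    (B : PiLp 2 H → Set (PiLp 2 H)) (C : ∀ i, PiLp 2 H → Set (H i))
    (hC : inverseOp B = prodOp C) (u : PiLp 2 H) :
    u ∈ dualSolutions A B ↔ ∀ i, (0 : H i) ∈ -(inverseOp (A i) (-(u i))) + C i u := by
  simp only [dualSolutions, hC, Set.mem_ofPred_eq, Set.mem_add]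
  constructor
  · rintro ⟨a, ha, b, hb, hab⟩ i
    exact ⟨a i, by simpa using ha i, b i, hb i,
      by simpa using congrArg (fun y : PiLp 2 H => y i) hab⟩
  · intro h
    choose a ha b hb hab using h
    exact ⟨WithLp.toLp 2 a, fun i => by simpa using ha i, WithLp.toLp 2 b, hb,
      by ext i; simpa using hab i⟩

/-- The set `{0,1}^m ∖ {0}` of nonempty block selections. -/
abbrev Selection (m : ℕ) : Type := {e : Fin m → Fin 2 // e ≠ 0}

end Blocks

/-- The σ-algebra `σ(x₀, …, xₙ)` generated by the first `n + 1` terms of a process. -/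
abbrev history {Ω E : Type*} [MeasurableSpace E] (x : ℕ → Ω → E) (n : ℕ) : MeasurableSpace Ω :=
  ⨆ k ≤ n, MeasurableSpace.comap (x k) inferInstance

/-- The extended real random variable `∑ₙ √(E(‖aₙ‖² | 𝓧ₙ))`, where the conditional expectation is
that of a `[0,∞]`-valued random variable. -/
noncomputable def errorSum {Ω E : Type*} [MeasurableSpace Ω] [NormedAddCommGroup E]
    (P : Measure Ω) (𝓧 : ℕ → MeasurableSpace Ω) (a : ℕ → Ω → E) (ω : Ω) : ℝ≥0∞ :=
  ∑' n, (condLExp (𝓧 n) P (fun ω' => ‖a n ω'‖ₑ ^ 2) ω) ^ (1 / 2 : ℝ)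

end BlockDR

open BlockDR

namespace BlockDR

/-! ### Minty's theorem, firmly nonexpansive resolvents, the Douglas–Rachford operator -/

section Minty

variable {E : Type*} [NormedAddCommGroup E] [InnerProductSpace ℝ E]

/-! Let `T x = x + J_A(2 Q x - x) - Q x`, where `Q` is the resolvent of `γB` and `J_A` acts
blockwise. Minty's theorem makes the resolvents everywhere defined and firmly nonexpansive, hence
`T` is firmly nonexpansive too. If `x` is a fixed point, `Q x` is a primal solution and `γ⁻¹(x - Q
x)` a dual one, and a primal solution yields a fixed point. An activated block first resets `z` to
`Q x + b`, so the algorithm is a block-coordinate relaxed iteration of `T` with an error controlled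
by `a` and `b`.

Weight block `i` by `1/pᵢ`, with `pᵢ` its activation probability. Since `εₙ` is independent of the
past, averaging turns the weighted squared distance to a fixed point into the old weighted one plus
the change in the unweighted one under a full step of `T`, which is at most `-μ(2-μ)‖Tx - x‖²`.
Young's inequality with the summable parameter `αₙ` absorbs the errors, and the Robbins–Siegmund
theorem (`robbinsSiegmund`) gives almost sure convergence of the weighted distances and `Txₙ - xₙ →
0`. Nothing is assumed integrable, so conditional inequalities are stated as integrals against
nonnegative weights. Demiclosedness and an Opial argument in the weighted inner product
(`exists_weaklyTendsto_fixedPoint`) finish the weak convergence.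

For `zₙ`, the second Borel–Cantelli lemma makes each block active infinitely often. Between
activations `z` is frozen, so it inherits the weak limit of `Q xₙ + bₙ`. -/

theorem norm_half_add_sq (p q : E) :
    ‖(1 / 2 : ℝ) • p + (1 / 2 : ℝ) • q‖ ^ 2 =
      1 / 2 * ‖p‖ ^ 2 + 1 / 2 * ‖q‖ ^ 2 - 1 / 4 * ‖p - q‖ ^ 2 := by
  rw [norm_add_sq_real, norm_sub_sq_real, norm_smul, norm_smul, inner_smul_left, inner_smul_right]
  simp
  ring

/-- A closed convex subset of `E × ℝ` on which `(p, r) ↦ r + ‖p‖² / 2` is bounded below contains a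
minimizer of this function. -/
theorem exists_isMinOn_add_half_norm_sq [CompleteSpace E] {K : Set (E × ℝ)} (hne : K.Nonempty)
    (hconv : Convex ℝ K) (hcl : IsClosed K) (h0 : ∀ q ∈ K, 0 ≤ q.2 + ‖q.1‖ ^ 2 / 2) :
    ∃ p ∈ K, ∀ q ∈ K, p.2 + ‖p.1‖ ^ 2 / 2 ≤ q.2 + ‖q.1‖ ^ 2 / 2 := by
  set f : E × ℝ → ℝ := fun q => q.2 + ‖q.1‖ ^ 2 / 2 with hf
  have hbdd : BddBelow (f '' K) := ⟨0, by rintro _ ⟨q, hq, rfl⟩; exact h0 q hq⟩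
  set I := sInf (f '' K) with hI
  have hle : ∀ q ∈ K, I ≤ f q := fun q hq => csInf_le hbdd ⟨q, hq, rfl⟩
  have hex : ∀ n : ℕ, ∃ q ∈ K, f q < I + 1 / ((n : ℝ) + 1) := by
    intro n
    obtain ⟨_, ⟨q, hq, rfl⟩, hlt⟩ := exists_lt_of_csInf_lt (hne.image f)
      (show sInf (f '' K) < I + 1 / ((n : ℝ) + 1) by
        have : (0 : ℝ) < 1 / ((n : ℝ) + 1) := by positivity
        linarith)
    exact ⟨q, hq, hlt⟩
  choose q hqK hqlt using hex
  -- Midpoints stay in `K`, so strong convexity of the squared norm makes minimizing sequences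
  -- Cauchy in the first component; the second component is then recovered from the values of `f`.
  have hmid : ∀ k l, ‖(q k).1 - (q l).1‖ ^ 2 ≤
      4 * (1 / ((k : ℝ) + 1) + 1 / ((l : ℝ) + 1)) := by
    intro k l
    have h1 := hle _ (hconv (hqK k) (hqK l) (by norm_num : (0 : ℝ) ≤ 1 / 2)
      (by norm_num : (0 : ℝ) ≤ 1 / 2) (by norm_num))
    have h2 := hqlt k
    have h3 := hqlt l
    simp only [hf, Prod.fst_add, Prod.smul_fst, Prod.snd_add, Prod.smul_snd, norm_half_add_sq,
      smul_eq_mul] at h1 h2 h3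
    linarith
  have hcau : CauchySeq fun k => (q k).1 := by
    refine Metric.cauchySeq_iff'.2 fun e he => ?_
    obtain ⟨N, hN⟩ := exists_nat_one_div_lt (show (0 : ℝ) < e ^ 2 / 8 by positivity)
    refine ⟨N, fun k hk => ?_⟩
    have h1 : 1 / ((k : ℝ) + 1) ≤ 1 / ((N : ℝ) + 1) := by gcongr
    have h2 := hmid k N
    rw [dist_eq_norm]
    exact lt_of_pow_lt_pow_left₀ 2 he.le (by linarith)
  obtain ⟨p, hp⟩ := cauchySeq_tendsto_of_complete hcau
  have hflim : Tendsto (fun k => f (q k)) atTop (𝓝 I) := by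
    refine tendsto_of_tendsto_of_tendsto_of_le_of_le tendsto_const_nhds ?_
      (fun k => hle _ (hqK k)) (fun k => (hqlt k).le)
    simpa using tendsto_const_nhds.add (tendsto_one_div_add_atTop_nhds_zero_nat (𝕜 := ℝ))
  have hr : Tendsto (fun k => (q k).2) atTop (𝓝 (I - ‖p‖ ^ 2 / 2)) := by
    have := hflim.sub (((hp.norm).pow 2).div_const 2)
    refine this.congr fun k => ?_
    simp [hf]
  refine ⟨(p, I - ‖p‖ ^ 2 / 2),
    hcl.mem_of_tendsto (hp.prodMk_nhds hr) (Eventually.of_forall hqK), fun y hy => ?_⟩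
  have := hle y hy
  simp only [hf] at this
  simpa using this

/-- First order optimality condition for the minimization of `(p, r) ↦ r + ‖p‖² / 2` over a convex
set. -/
theorem le_add_inner_of_isMinOn {K : Set (E × ℝ)} (hconv : Convex ℝ K) {p q : E × ℝ}
    (hp : p ∈ K) (hq : q ∈ K)
    (hmin : ∀ q ∈ K, p.2 + ‖p.1‖ ^ 2 / 2 ≤ q.2 + ‖q.1‖ ^ 2 / 2) :
    p.2 ≤ q.2 + inner ℝ p.1 (q.1 - p.1) := by
  by_contra! hlt
  set d := p.2 - q.2 - inner ℝ p.1 (q.1 - p.1) with hd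
  have hdpos : 0 < d := by linarith
  set M := ‖q.1 - p.1‖ ^ 2 with hM
  have hM0 : 0 ≤ M := by positivity
  -- Moving a fraction `t` towards `q` changes the objective by `-t d + t² M / 2`, which is negative
  -- for this `t`.
  set t : ℝ := min 1 (d / (M + 1)) with ht
  have ht0 : 0 < t := by positivity
  have ht1 : t ≤ 1 := min_le_left _ _
  have htM : t * (M + 1) ≤ d := by
    have := min_le_right 1 (d / (M + 1))
    rwa [← ht, le_div_iff₀ (by positivity)] at this
  have key := hmin _ (hconv hp hq (sub_nonneg.2 ht1) ht0.le (by ring))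
  have e : ‖(1 - t) • p.1 + t • q.1‖ ^ 2 =
      ‖p.1‖ ^ 2 + 2 * (t * inner ℝ p.1 (q.1 - p.1)) + t ^ 2 * M := by
    have : (1 - t) • p.1 + t • q.1 = p.1 + t • (q.1 - p.1) := by module
    rw [this, norm_add_sq_real, inner_smul_right, norm_smul, mul_pow, hM, Real.norm_eq_abs, sq_abs]
  simp only [Prod.fst_add, Prod.smul_fst, Prod.snd_add, Prod.smul_snd, smul_eq_mul, e] at key
  have h1 : 0 ≤ t * (-d + t * M / 2) := by rw [hd]; nlinarith
  have h2 := nonneg_of_mul_nonneg_right h1 ht0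
  nlinarith

/-- Adjoining `(x, u)` to the graph keeps it monotone, so maximality forces the point to be there
already. -/
theorem IsMaximallyMonotone.mem_of_forall {A : E → Set E} (hA : IsMaximallyMonotone A) {x u : E}
    (h : ∀ y v, v ∈ A y → 0 ≤ inner ℝ (x - y) (u - v)) : u ∈ A x := by
  classical
  refine hA.2 (fun y => {v | v ∈ A y ∨ (y = x ∧ v = u)}) ?_ (fun y v hv => Or.inl hv) x
    (Or.inr ⟨rfl, rfl⟩)
  rintro y y' v v' (hv | ⟨rfl, rfl⟩) (hv' | ⟨rfl, rfl⟩)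
  · exact hA.1 _ _ _ _ hv hv'
  · have := h _ _ hv
    rwa [← neg_sub y, ← neg_sub v, inner_neg_neg] at this
  · exact h _ _ hv'
  · simp

theorem IsMaximallyMonotone.exists_mem {A : E → Set E} (hA : IsMaximallyMonotone A) :
    ∃ x u, u ∈ A x := by
  by_contra! h
  exact h 0 0 (hA.mem_of_forall fun y v hv => absurd hv (h y v))

/-- **Minty's theorem** at the origin, through the Fitzpatrick function. -/
theorem IsMaximallyMonotone.exists_neg_mem [CompleteSpace E] {A : E → Set E}
    (hA : IsMaximallyMonotone A) : ∃ x, -x ∈ A x := by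
  let c : E → E → WithLp 2 (E × E) → ℝ := fun y v p =>
    inner ℝ y p.snd + inner ℝ p.fst v - inner ℝ y v
  -- `K` is the epigraph of the Fitzpatrick function, the supremum of the affine functions `c y v`
  -- over the graph.
  let K : Set (WithLp 2 (E × E) × ℝ) := {q | ∀ y v, v ∈ A y → c y v q.1 ≤ q.2}
  have hc : ∀ y v (p : WithLp 2 (E × E)),
      c y v p = inner ℝ p.fst p.snd - inner ℝ (p.fst - y) (p.snd - v) := by
    intro y v p
    simp only [c, inner_sub_left, inner_sub_right]
    ring
  have hgr : ∀ x u, u ∈ A x → ((WithLp.toLp 2 (x, u), inner ℝ x u) : _ × ℝ) ∈ K := by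
    intro x u hu y v hv
    have := hA.1 _ _ _ _ hu hv
    rw [hc]
    change inner ℝ x u - inner ℝ (x - y) (u - v) ≤ inner ℝ x u
    linarith
  -- The Fitzpatrick function dominates the duality pairing: a point violating this would be
  -- monotonically related to the graph, hence in it, and testing it against itself gives a
  -- contradiction.
  have hlow : ∀ q ∈ K, inner ℝ q.1.fst q.1.snd ≤ q.2 := by
    intro q hq
    by_contra! hlt
    have hmem : q.1.snd ∈ A q.1.fst := by
      refine hA.mem_of_forall fun y v hv => ?_
      have := hq y v hv
      rw [hc] at this
      linarith
    have := hq _ _ hmem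
    simp only [hc, sub_self, inner_zero_left, sub_zero] at this
    linarith
  have hconv : Convex ℝ K := by
    intro q hq q' hq' s t hs ht hst y v hv
    have h1 := mul_le_mul_of_nonneg_left (hq y v hv) hs
    have h2 := mul_le_mul_of_nonneg_left (hq' y v hv) ht
    have : c y v (s • q + t • q').1 = s * c y v q.1 + t * c y v q'.1 := by
      simp only [c, Prod.fst_add, Prod.smul_fst, WithLp.add_fst, WithLp.add_snd, WithLp.smul_fst,
        WithLp.smul_snd, inner_add_left, inner_add_right, inner_smul_left, inner_smul_right]
      simp only [conj_trivial]
      linear_combination (inner ℝ y v) * (hst)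
    simp only [this, Prod.snd_add, Prod.smul_snd, smul_eq_mul]
    linarith
  have hcl : IsClosed K := by
    simp only [K, Set.ofPred_forall]
    refine isClosed_iInter fun y => isClosed_iInter fun v => isClosed_iInter fun _ => ?_
    refine isClosed_le ?_ continuous_snd
    simp only [c]
    fun_prop
  obtain ⟨x₀, u₀, hu₀⟩ := hA.exists_mem
  obtain ⟨q, hq, hmin⟩ := exists_isMinOn_add_half_norm_sq ⟨_, hgr x₀ u₀ hu₀⟩ hconv hcl (by
    intro q hq
    have h1 := hlow q hq
    have h2 := norm_add_sq_real q.1.fst q.1.snd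
    rw [WithLp.prod_norm_sq_eq_of_L2]
    nlinarith [sq_nonneg ‖q.1.fst + q.1.snd‖])
  set x := q.1.fst
  set u := q.1.snd
  -- Optimality of `(x, u)` tested at graph points. This places `(-u, -x)` in the graph, and taking
  -- `(y, v)` equal to that pair then forces `u = -x`.
  have hbound : ∀ y v, v ∈ A y → ‖x + u‖ ^ 2 ≤ inner ℝ (-u - y) (-x - v) := by
    intro y v hv
    have h1 := le_add_inner_of_isMinOn hconv hq (hgr y v hv) hmin
    have h2 := hlow q hq
    simp only [WithLp.prod_inner_apply, WithLp.ofLp_sub, Prod.fst_sub, Prod.snd_sub] at h1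
    change q.2 ≤ inner ℝ y v + (inner ℝ x (y - x) + inner ℝ u (v - u)) at h1
    change inner ℝ x u ≤ q.2 at h2
    rw [norm_add_sq_real]
    simp only [inner_sub_left, inner_sub_right, inner_neg_left, inner_neg_right,
      real_inner_self_eq_norm_sq] at h1 ⊢
    rw [real_inner_comm x u, real_inner_comm x y]
    linarith
  have hmem : -x ∈ A (-u) := hA.mem_of_forall fun y v hv => (sq_nonneg _).trans (hbound y v hv)
  have h0 := hbound _ _ hmem
  simp only [sub_self, inner_zero_left] at h0
  have hxu : x + u = 0 := by
    have := le_antisymm h0 (sq_nonneg _)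
    simpa using this
  refine ⟨x, ?_⟩
  rwa [neg_eq_of_add_eq_zero_left hxu] at hmem

/-- Scaling and translating values reduces the resolvent of `γA` at `w` to Minty's theorem at the
origin for `γA - w`. -/
theorem IsMaximallyMonotone.smul_sub {A : E → Set E} (hA : IsMaximallyMonotone A) {γ : ℝ}
    (hγ : 0 < γ) (w : E) : IsMaximallyMonotone fun y => {v | v + w ∈ γ • A y} := by
  have hmem : ∀ y v, v + w ∈ γ • A y ↔ γ⁻¹ • (v + w) ∈ A y := fun y v =>
    Set.mem_smul_set_iff_inv_smul_mem₀ hγ.ne' _ _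
  have hmono : IsMonotone fun y => {v | v + w ∈ γ • A y} := by
    intro x y u v hu hv
    have := hA.1 _ _ _ _ ((hmem _ _).1 hu) ((hmem _ _).1 hv)
    rw [← _root_.smul_sub, inner_smul_right, add_sub_add_right_eq_sub] at this
    exact nonneg_of_mul_nonneg_right this (inv_pos.2 hγ)
  refine ⟨hmono, fun A' hA' hsub x u hu => (hmem _ _).2 (hA.mem_of_forall fun y v hv => ?_)⟩
  have h1 : γ • v - w ∈ A' y := hsub y ((hmem _ _).2 (by simpa [hγ.ne'] using hv))
  have h2 := hA' _ _ _ _ hu h1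
  have : γ⁻¹ • (u + w) - v = γ⁻¹ • (u - (γ • v - w)) := by
    rw [_root_.smul_sub, _root_.smul_sub, smul_smul, inv_mul_cancel₀ hγ.ne']
    module
  rw [this, inner_smul_right]
  exact mul_nonneg (inv_pos.2 hγ).le h2

theorem IsMonotone.smul {A : E → Set E} (hA : IsMonotone A) {γ : ℝ}
    (hγ : 0 < γ) : IsMonotone fun y => γ • A y := by
  rintro x y _ _ ⟨u, hu, rfl⟩ ⟨v, hv, rfl⟩
  simp only [← _root_.smul_sub, inner_smul_right]
  exact mul_nonneg hγ.le (hA _ _ _ _ hu hv)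

/-- **Minty's theorem**: the resolvent of `γ A` is everywhere defined. -/
theorem IsMaximallyMonotone.sub_resolventMap_mem [CompleteSpace E] {A : E → Set E}
    (hA : IsMaximallyMonotone A) {γ : ℝ} (hγ : 0 < γ) (w : E) :
    w - resolventMap (fun y => γ • A y) w ∈ γ • A (resolventMap (fun y => γ • A y) w) := by
  obtain ⟨p, hp⟩ := (hA.smul_sub hγ w).exists_neg_mem
  have hp' : w - p ∈ γ • A p := by simpa [neg_add_eq_sub] using hp
  rw [resolventMap_eq_of_mem (hA.1.smul hγ) (mem_setResolvent.2 hp')]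
  exact hp'

theorem resolventMap_smul_eq_iff [CompleteSpace E] {A : E → Set E}
    (hA : IsMaximallyMonotone A) {γ : ℝ} (hγ : 0 < γ) {w p : E} :
    resolventMap (fun y => γ • A y) w = p ↔ γ⁻¹ • (w - p) ∈ A p := by
  rw [← Set.mem_smul_set_iff_inv_smul_mem₀ hγ.ne']
  constructor
  · rintro rfl
    exact hA.sub_resolventMap_mem hγ w
  · exact fun h => resolventMap_eq_of_mem (hA.1.smul hγ) (mem_setResolvent.2 h)

/-- The operator `J` is firmly nonexpansive. -/
def IsFirmlyNonexpansive (J : E → E) : Prop :=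
  ∀ x y, ‖J x - J y‖ ^ 2 ≤ inner ℝ (x - y) (J x - J y)

theorem IsMaximallyMonotone.isFirmlyNonexpansive_resolventMap [CompleteSpace E] {A : E → Set E}
    (hA : IsMaximallyMonotone A) {γ : ℝ} (hγ : 0 < γ) :
    IsFirmlyNonexpansive (resolventMap fun y => γ • A y) := by
  intro x y
  have := hA.1.smul hγ _ _ _ _ (hA.sub_resolventMap_mem hγ x) (hA.sub_resolventMap_mem hγ y)
  rw [real_inner_comm, sub_sub_sub_comm, inner_sub_left, real_inner_self_eq_norm_sq] at this
  linarith

theorem IsFirmlyNonexpansive.norm_sub_le {J : E → E} (hJ : IsFirmlyNonexpansive J) (x y : E) :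
    ‖J x - J y‖ ≤ ‖x - y‖ := by
  have h1 := (hJ x y).trans (real_inner_le_norm _ _)
  by_contra! h
  nlinarith [norm_nonneg (x - y), norm_nonneg (J x - J y)]

theorem IsFirmlyNonexpansive.continuous {J : E → E} (hJ : IsFirmlyNonexpansive J) :
    Continuous J :=
  (LipschitzWith.of_dist_le_mul (K := 1) fun x y => by
    simpa [dist_eq_norm] using hJ.norm_sub_le x y).continuous

/-- The Douglas–Rachford operator built from two resolvents. -/
def drOp (JA JB : E → E) (x : E) : E := x + JA ((2 : ℝ) • JB x - x) - JB x

/-- The claim is the sum of the inequality for `JA` at the reflected points `2 JB x - x`, `2 JB y -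
y` and the one for `JB` at `x`, `y`. -/
theorem IsFirmlyNonexpansive.drOp {JA JB : E → E} (hA : IsFirmlyNonexpansive JA)
    (hB : IsFirmlyNonexpansive JB) : IsFirmlyNonexpansive (drOp JA JB) := by
  intro x y
  have h1 := hA ((2 : ℝ) • JB x - x) ((2 : ℝ) • JB y - y)
  have h2 := hB x y
  have e1 : (2 : ℝ) • JB x - x - ((2 : ℝ) • JB y - y) = (2 : ℝ) • (JB x - JB y) - (x - y) := by
    module
  rw [e1] at h1
  set q := JA ((2 : ℝ) • JB x - x) - JA ((2 : ℝ) • JB y - y) with hq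
  set p := JB x - JB y with hp
  set d := x - y
  have e2 : BlockDR.drOp JA JB x - BlockDR.drOp JA JB y = d + q - p := by
    simp only [BlockDR.drOp, hq, hp, d]
    abel
  rw [e2, ← real_inner_self_eq_norm_sq]
  rw [← real_inner_self_eq_norm_sq] at h1 h2
  simp only [inner_sub_left, inner_sub_right, inner_add_left, inner_add_right,
    inner_smul_left, conj_trivial] at h1 h2 ⊢
  rw [real_inner_comm d q, real_inner_comm d p, real_inner_comm p q]
  linarith

/-- Relaxed iterations of a firmly nonexpansive operator decrease the distance to fixed points. -/
theorem IsFirmlyNonexpansive.norm_relaxation_sq_le {T : E → E} (hT : IsFirmlyNonexpansive T)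
    (x : E) {y : E} (hy : T y = y) {μ : ℝ} (hμ : 0 ≤ μ) :
    ‖x + μ • (T x - x) - y‖ ^ 2 ≤ ‖x - y‖ ^ 2 - μ * (2 - μ) * ‖T x - x‖ ^ 2 := by
  have h := hT x y
  rw [hy] at h
  have e1 : x + μ • (T x - x) - y = (x - y) + μ • (T x - x) := by abel
  have e2 : T x - y = (x - y) + (T x - x) := by abel
  rw [e2, norm_add_sq_real, inner_add_right, real_inner_self_eq_norm_sq] at h
  rw [e1, norm_add_sq_real, inner_smul_right, norm_smul, mul_pow, Real.norm_eq_abs, sq_abs]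
  nlinarith

end Minty

/-! ### Almost supermartingales: the Robbins–Siegmund theorem -/

section AlmostSupermartingale

variable {Ω : Type*} {mΩ : MeasurableSpace Ω} {P : Measure Ω}

/-- The measures with densities `X` and `condLExp F P X` agree on `F`, and `g` only sees `F`.
Infinite values are allowed. -/
theorem lintegral_mul_condLExp [IsFiniteMeasure P] {F : MeasurableSpace Ω} (hF : F ≤ mΩ)
    {X g : Ω → ℝ≥0∞} (hX : Measurable[mΩ] X) (hg : Measurable[F] g) :
    ∫⁻ ω, g ω * condLExp F P X ω ∂P = ∫⁻ ω, g ω * X ω ∂P := by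
  have hc : Measurable[mΩ] (condLExp F P X) := (measurable_condLExp F P X).mono hF le_rfl
  have htrim : (P.withDensity (condLExp F P X)).trim hF = (P.withDensity X).trim hF := by
    refine @Measure.ext Ω F _ _ fun s hs => ?_
    rw [trim_measurableSet_eq hF hs, trim_measurableSet_eq hF hs,
      withDensity_apply _ (hF s hs), withDensity_apply _ (hF s hs), setLIntegral_condLExp hF P X hs]
  have h1 := lintegral_withDensity_eq_lintegral_mul P hc (hg.mono hF le_rfl)
  have h2 := lintegral_withDensity_eq_lintegral_mul P hX (hg.mono hF le_rfl)
  rw [← lintegral_trim hF hg] at h1 h2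
  rw [htrim, h2] at h1
  simp only [Pi.mul_apply] at h1
  simp only [mul_comm (g _)]
  exact h1.symm

/-- The bound on `U 0` propagates along the inequality over the whole space, so every `U n` is
integrable and the supermartingale convergence theorem applies. -/
theorem ae_tendsto_of_nonneg_of_setLIntegral_succ_le [IsFiniteMeasure P] (F : Filtration ℕ mΩ)
    {U : ℕ → Ω → ℝ} (hU0 : ∀ n ω, 0 ≤ U n ω) (hU : ∀ n, Measurable[F n] (U n))
    {C : ℝ} (hC : ∀ ω, U 0 ω ≤ C)
    (hs : ∀ n (s : Set Ω), MeasurableSet[F n] s →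
      ∫⁻ ω in s, ENNReal.ofReal (U (n + 1) ω) ∂P ≤ ∫⁻ ω in s, ENNReal.ofReal (U n ω) ∂P) :
    ∀ᵐ ω ∂P, ∃ l, Tendsto (fun n => U n ω) atTop (𝓝 l) := by
  have hUm : ∀ n, Measurable (U n) := fun n => (hU n).mono (F.le n) le_rfl
  set R := ENNReal.ofReal C * P Set.univ with hR
  have hRtop : R < ∞ := ENNReal.mul_lt_top ENNReal.ofReal_lt_top (measure_lt_top _ _)
  have hlint : ∀ n, ∫⁻ ω, ENNReal.ofReal (U n ω) ∂P ≤ R := by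
    intro n
    induction n with
    | zero =>
      calc _ ≤ ∫⁻ _, ENNReal.ofReal C ∂P :=
            lintegral_mono fun ω => ENNReal.ofReal_le_ofReal (hC ω)
        _ = R := by rw [lintegral_const]
    | succ n ih =>
      have := hs n Set.univ MeasurableSet.univ
      rw [Measure.restrict_univ] at this
      exact this.trans ih
  have hint : ∀ n, Integrable (U n) P := by
    intro n
    refine ⟨(hUm n).aestronglyMeasurable, ?_⟩
    rw [hasFiniteIntegral_iff_ofReal (Eventually.of_forall (hU0 n))]
    exact (hlint n).trans_lt hRtop
  have hsuper : Supermartingale U F P := by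
    refine supermartingale_of_setIntegral_succ_le (fun n => (hU n).stronglyMeasurable) hint ?_
    intro n s hsm
    rw [integral_eq_lintegral_of_nonneg_ae (Eventually.of_forall (hU0 _))
      (hUm _).aestronglyMeasurable, integral_eq_lintegral_of_nonneg_ae
      (Eventually.of_forall (hU0 _)) (hUm _).aestronglyMeasurable]
    refine ENNReal.toReal_mono ?_ (hs n s hsm)
    exact ((setLIntegral_le_lintegral _ _).trans_lt ((hlint n).trans_lt hRtop)).ne
  have hb : ∀ n, eLpNorm ((-U) n) 1 P ≤ (R.toNNReal : ℝ≥0∞) := by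
    intro n
    rw [ENNReal.coe_toNNReal hRtop.ne, Pi.neg_apply, eLpNorm_neg, eLpNorm_one_eq_lintegral_enorm]
    refine (lintegral_congr fun ω => ?_).trans_le (hlint n)
    rw [Real.enorm_eq_ofReal (hU0 n ω)]
  filter_upwards [hsuper.neg.exists_ae_tendsto_of_bdd hb] with ω ⟨l, hl⟩
  refine ⟨-l, ?_⟩
  simpa using hl.neg

/-- The **Robbins–Siegmund theorem** without integrability assumptions: the conditional inequality
`E(ξ (n + 1) + η n | F n) ≤ ξ n + β n` is tested against nonnegative `F n`-measurable weights. -/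
theorem robbinsSiegmund_add [IsFiniteMeasure P] (F : Filtration ℕ mΩ) {ξ η β : ℕ → Ω → ℝ}
    (hξ0 : ∀ n ω, 0 ≤ ξ n ω) (hη0 : ∀ n ω, 0 ≤ η n ω) (hβ0 : ∀ n ω, 0 ≤ β n ω)
    (hξ : ∀ n, Measurable[F n] (ξ n)) (hη : ∀ n, Measurable[F n] (η n))
    (hβ : ∀ n, Measurable[F n] (β n))
    (h : ∀ n (g : Ω → ℝ≥0∞), Measurable[F n] g →
      ∫⁻ ω, g ω * ENNReal.ofReal (ξ (n + 1) ω + η n ω) ∂P ≤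
        ∫⁻ ω, g ω * ENNReal.ofReal (ξ n ω + β n ω) ∂P)
    (hsum : ∀ᵐ ω ∂P, Summable fun n => β n ω) :
    ∀ᵐ ω ∂P, (∃ l, Tendsto (fun n => ξ n ω) atTop (𝓝 l)) ∧ Summable fun n => η n ω := by
  set S : ℕ → Ω → ℝ := fun n ω => ∑ k ∈ Finset.range n, β k ω with hS
  set R : ℕ → Ω → ℝ := fun n ω => ∑ k ∈ Finset.range n, η k ω with hR
  have hSm : ∀ n m, (∀ k < n, k ≤ m) → Measurable[F m] (S n) := fun n m hnm =>
    Finset.measurable_fun_sum _ fun k hk =>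
      (hβ k).mono (F.mono (hnm k (Finset.mem_range.1 hk))) le_rfl
  have hRm : ∀ n, Measurable[F n] (R n) := fun n =>
    Finset.measurable_fun_sum _ fun k hk =>
      (hη k).mono (F.mono (Finset.mem_range.1 hk).le) le_rfl
  have hR0 : ∀ n ω, 0 ≤ R n ω := fun n ω => Finset.sum_nonneg fun k _ => hη0 k ω
  have hSmono : ∀ ω, Monotone fun n => S n ω := fun ω =>
    monotone_nat_of_le_succ fun n => by simp [hS, Finset.sum_range_succ, hβ0]
  -- Localization replaces integrability. `S (n + 1)` only involves `β 0, …, β n`, so `D N (n + 1)`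
  -- lies in `F n` and its indicator is an admissible weight; the sets decrease with `n`.
  let D : ℕ → ℕ → Set Ω := fun N n => {ω | ξ 0 ω ≤ N ∧ S n ω ≤ N}
  have hDm : ∀ N n m, (∀ k < n, k ≤ m) → MeasurableSet[F m] (D N n) := fun N n m hnm =>
    MeasurableSet.inter
      ((hξ 0).mono (F.mono (Nat.zero_le m)) le_rfl measurableSet_Iic)
      (hSm n m hnm measurableSet_Iic)
  -- Adding the accumulated `η` and subtracting the accumulated `β` compensates the inequality; the
  -- shift by `N` keeps `U` nonnegative on `D`.
  let U : ℕ → ℕ → Ω → ℝ := fun N n => (D N n).indicator fun ω => ξ n ω + R n ω + (N - S n ω)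
  have hconv : ∀ N, ∀ᵐ ω ∂P, ∃ l, Tendsto (fun n => U N n ω) atTop (𝓝 l) := by
    intro N
    refine ae_tendsto_of_nonneg_of_setLIntegral_succ_le F (C := 2 * N) ?_ ?_ ?_ ?_
    · intro n ω
      refine Set.indicator_nonneg (fun ω hω => ?_) ω
      have := hξ0 n ω
      have := hR0 n ω
      have := hω.2
      linarith
    · intro n
      refine Measurable.indicator ?_ (hDm N n n fun k hk => hk.le)
      exact ((hξ n).add (hRm n)).add (Measurable.const_sub (hSm n n fun k hk => hk.le) _)
    · intro ω
      refine Set.indicator_apply_le' (fun hω => ?_) fun _ => by positivity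
      have := hω.1
      simp only [hS, hR, Finset.range_zero, Finset.sum_empty]
      linarith
    · intro n s hs
      have hsD : MeasurableSet[F n] (s ∩ D N (n + 1)) :=
        MeasurableSet.inter hs (hDm N (n + 1) n fun k hk => Nat.lt_succ_iff.1 hk)
      set g : Ω → ℝ≥0∞ := (s ∩ D N (n + 1)).indicator 1 with hg
      have hgm : Measurable[F n] g := Measurable.indicator measurable_const hsD
      set r : Ω → ℝ := fun ω => R n ω + (N - S (n + 1) ω) with hr
      have hrm : Measurable (g * fun ω => ENNReal.ofReal (r ω)) := by
        refine (hgm.mono (F.le n) le_rfl).mul (Measurable.ennreal_ofReal ?_)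
        exact ((hRm n).mono (F.le n) le_rfl).add (Measurable.const_sub
          ((hSm (n + 1) (n + 1) fun k hk => hk.le).mono (F.le _) le_rfl) _)
      rw [← lintegral_indicator (F.le n s hs), ← lintegral_indicator (F.le n s hs)]
      calc _ = ∫⁻ ω, (g * fun ω => ENNReal.ofReal (r ω)) ω +
                g ω * ENNReal.ofReal (ξ (n + 1) ω + η n ω) ∂P := by
            refine lintegral_congr fun ω => ?_
            by_cases hωs : ω ∈ s
            · by_cases hωD : ω ∈ D N (n + 1)
              · have h1 := hR0 n ω
                have h2 := hωD.2
                have hω : ω ∈ s ∩ D N (n + 1) := ⟨hωs, hωD⟩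
                rw [Pi.mul_apply, hg, Set.indicator_of_mem hωs,
                  Set.indicator_of_mem hω, Pi.one_apply, one_mul, one_mul,
                  ← ENNReal.ofReal_add (by simp only [hr]; linarith)
                  (add_nonneg (hξ0 _ _) (hη0 _ _))]
                simp only [U, Set.indicator_of_mem hωD, hr]
                simp only [hR, Finset.sum_range_succ]
                congr 1
                ring
              · simp [U, hg, hωs, hωD]
            · simp [hg, hωs]
        _ = ∫⁻ ω, (g * fun ω => ENNReal.ofReal (r ω)) ω ∂P +
              ∫⁻ ω, g ω * ENNReal.ofReal (ξ (n + 1) ω + η n ω) ∂P := lintegral_add_left hrm _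
        _ ≤ ∫⁻ ω, (g * fun ω => ENNReal.ofReal (r ω)) ω ∂P +
              ∫⁻ ω, g ω * ENNReal.ofReal (ξ n ω + β n ω) ∂P := add_le_add le_rfl (h n g hgm)
        _ = ∫⁻ ω, (g * fun ω => ENNReal.ofReal (r ω)) ω +
              g ω * ENNReal.ofReal (ξ n ω + β n ω) ∂P := (lintegral_add_left hrm _).symm
        _ ≤ _ := by
            refine lintegral_mono fun ω => ?_
            by_cases hω : ω ∈ s ∩ D N (n + 1)
            · have h1 := hR0 n ω
              have h2 := hω.2.2
              have hωD : ω ∈ D N n := ⟨hω.2.1, (hSmono ω n.le_succ).trans h2⟩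
              rw [Pi.mul_apply, hg, Set.indicator_of_mem hω.1, Set.indicator_of_mem hω,
                Pi.one_apply, one_mul, one_mul, ← ENNReal.ofReal_add (by simp only [hr]; linarith)
                (add_nonneg (hξ0 _ _) (hβ0 _ _))]
              simp only [U, Set.indicator_of_mem hωD, hr]
              simp only [hS, Finset.sum_range_succ]
              refine ENNReal.ofReal_le_ofReal ?_
              linarith
            · simp [hg, hω]
  filter_upwards [ae_all_iff.2 hconv, hsum] with ω hω hβs
  obtain ⟨N, hN⟩ := exists_nat_ge (max (ξ 0 ω) (∑' n, β n ω))
  have hSle : ∀ n, S n ω ≤ N := fun n =>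
    (hβs.sum_le_tsum _ fun k _ => hβ0 k ω).trans ((le_max_right _ _).trans hN)
  have hD : ∀ n, ω ∈ D N n := fun n => ⟨(le_max_left _ _).trans hN, hSle n⟩
  obtain ⟨l, hl⟩ := hω N
  simp only [U, Set.indicator_of_mem (hD _)] at hl
  have hSl : Tendsto (fun n => S n ω) atTop (𝓝 (∑' n, β n ω)) := hβs.hasSum.tendsto_sum_nat
  have hl2 : Tendsto (fun n => ξ n ω + R n ω) atTop (𝓝 (l - (N - ∑' n, β n ω))) := by
    refine (hl.sub (tendsto_const_nhds.sub hSl)).congr fun n => ?_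
    ring
  obtain ⟨M, hM⟩ := hl2.bddAbove_range
  have hηs : Summable fun n => η n ω := by
    refine summable_of_sum_range_le (c := M) (fun n => hη0 n ω) fun n => ?_
    have := hM ⟨n, rfl⟩
    have := hξ0 n ω
    simp only [hR] at *
    linarith
  refine ⟨⟨_, (hl2.sub hηs.hasSum.tendsto_sum_nat).congr fun n => ?_⟩, hηs⟩
  simp [hR]

/-- The **Robbins–Siegmund theorem** without integrability assumptions: the conditional inequality
`E(ξ (n + 1) + η n | F n) ≤ (1 + χ n) ξ n + β n` is tested against nonnegative `F n`-measurable
weights. -/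
theorem robbinsSiegmund [IsFiniteMeasure P] (F : Filtration ℕ mΩ) {ξ η χ β : ℕ → Ω → ℝ}
    (hξ0 : ∀ n ω, 0 ≤ ξ n ω) (hη0 : ∀ n ω, 0 ≤ η n ω) (hχ0 : ∀ n ω, 0 ≤ χ n ω)
    (hβ0 : ∀ n ω, 0 ≤ β n ω)
    (hξ : ∀ n, Measurable[F n] (ξ n)) (hη : ∀ n, Measurable[F n] (η n))
    (hχ : ∀ n, Measurable[F n] (χ n)) (hβ : ∀ n, Measurable[F n] (β n))
    (h : ∀ n (g : Ω → ℝ≥0∞), Measurable[F n] g →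
      ∫⁻ ω, g ω * ENNReal.ofReal (ξ (n + 1) ω + η n ω) ∂P ≤
        ∫⁻ ω, g ω * ENNReal.ofReal ((1 + χ n ω) * ξ n ω + β n ω) ∂P)
    (hχsum : ∀ᵐ ω ∂P, Summable fun n => χ n ω)
    (hβsum : ∀ᵐ ω ∂P, Summable fun n => β n ω) :
    ∀ᵐ ω ∂P, (∃ l, Tendsto (fun n => ξ n ω) atTop (𝓝 l)) ∧ Summable fun n => η n ω := by
  -- Dividing by this product removes the factor `1 + χ n`. The division by `p (n + 1)`, which is `F
  -- n`-measurable, goes into the weight, and summability of `χ` bounds the products when undoing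
  -- it.
  set p : ℕ → Ω → ℝ := fun n ω => ∏ k ∈ Finset.range n, (1 + χ k ω) with hp
  have hp1 : ∀ n ω, 1 ≤ p n ω := fun n ω =>
    Finset.one_le_prod fun k _ => by simpa using hχ0 k ω
  have hp0 : ∀ n ω, 0 < p n ω := fun n ω => zero_lt_one.trans_le (hp1 n ω)
  have hpm : ∀ n m, (∀ k < n, k ≤ m) → Measurable[F m] (p n) := fun n m hnm =>
    Finset.measurable_fun_prod _ fun k hk =>
      ((hχ k).mono (F.mono (hnm k (Finset.mem_range.1 hk))) le_rfl).const_add 1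
  have hpm1 : ∀ n, Measurable[F n] (p (n + 1)) := fun n =>
    hpm _ _ fun k hk => Nat.lt_succ_iff.1 hk
  have key := robbinsSiegmund_add (P := P) F (ξ := fun n ω => ξ n ω / p n ω)
    (η := fun n ω => η n ω / p (n + 1) ω) (β := fun n ω => β n ω / p (n + 1) ω)
    (fun n ω => div_nonneg (hξ0 n ω) (hp0 n ω).le)
    (fun n ω => div_nonneg (hη0 n ω) (hp0 _ ω).le)
    (fun n ω => div_nonneg (hβ0 n ω) (hp0 _ ω).le)
    (fun n => (hξ n).div (hpm n n fun k hk => hk.le))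
    (fun n => (hη n).div (hpm1 n)) (fun n => (hβ n).div (hpm1 n)) ?_ ?_
  · filter_upwards [key, hχsum] with ω ⟨⟨l, hl⟩, hη'⟩ hχs
    have hmul := (Real.multipliable_one_add_of_summable hχs).hasProd.tendsto_prod_nat
    obtain ⟨M, hM⟩ := hmul.bddAbove_range
    refine ⟨⟨_, (hl.mul hmul).congr fun n => div_mul_cancel₀ _ (hp0 n ω).ne'⟩, ?_⟩
    refine Summable.of_nonneg_of_le (fun n => hη0 n ω) (fun n => ?_) (hη'.mul_left M)
    have h1 : p (n + 1) ω ≤ M := hM ⟨n + 1, rfl⟩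
    calc η n ω = p (n + 1) ω * (η n ω / p (n + 1) ω) := (mul_div_cancel₀ _ (hp0 _ ω).ne').symm
      _ ≤ _ := mul_le_mul_of_nonneg_right h1 (div_nonneg (hη0 n ω) (hp0 _ ω).le)
  · intro n g hg
    have h1 := h n (fun ω => g ω * ENNReal.ofReal (1 / p (n + 1) ω))
      (hg.mul (((hpm1 n).const_div 1).ennreal_ofReal))
    refine (lintegral_congr fun ω => ?_).trans_le (h1.trans_eq (lintegral_congr fun ω => ?_))
    · rw [mul_assoc, ← ENNReal.ofReal_mul (div_nonneg zero_le_one (hp0 _ ω).le)]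
      congr 2
      ring
    · rw [mul_assoc, ← ENNReal.ofReal_mul (div_nonneg zero_le_one (hp0 _ ω).le)]
      congr 2
      have h2 : p (n + 1) ω = p n ω * (1 + χ n ω) := Finset.prod_range_succ _ _
      have h3 : (1 + χ n ω) ≠ 0 := by have := hχ0 n ω; positivity
      rw [h2]
      field_simp [(hp0 n ω).ne']
  · filter_upwards [hβsum] with ω hω
    exact Summable.of_nonneg_of_le (fun n => div_nonneg (hβ0 n ω) (hp0 _ ω).le)
      (fun n => div_le_self (hβ0 n ω) (hp1 _ ω)) hω

end AlmostSupermartingale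

/-! ### Weak cluster points, demiclosedness, Opial's lemma, weak measurability -/

section WeakConvergence

variable {E : Type*} [NormedAddCommGroup E] [InnerProductSpace ℝ E]

/-- Banach–Alaoglu transported by the Riesz isomorphism; ultrafilters play the role of subsequences.
-/
theorem exists_tendsto_inner_of_ultrafilter [CompleteSpace E] {ι : Type*} (U : Ultrafilter ι)
    {x : ι → E} {C : ℝ} (hC : ∀ n, ‖x n‖ ≤ C) :
    ∃ y : E, ∀ v : E, Tendsto (fun n => (inner ℝ v (x n) : ℝ)) U (𝓝 (inner ℝ v y)) := by
  let f : ι → WeakDual ℝ E := fun n => StrongDual.toWeakDual (InnerProductSpace.toDual ℝ E (x n))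
  have hcpt := WeakDual.isCompact_closedBall (0 : StrongDual ℝ E) C
  have hmem : ∀ n, f n ∈ WeakDual.toStrongDual ⁻¹' Metric.closedBall (0 : StrongDual ℝ E) C := by
    intro n
    have : ‖InnerProductSpace.toDual ℝ E (x n)‖ ≤ C := by simpa using hC n
    exact mem_closedBall_zero_iff.2 this
  have hle : ((U.map f : Ultrafilter (WeakDual ℝ E)) : Filter (WeakDual ℝ E)) ≤
      𝓟 (WeakDual.toStrongDual ⁻¹' Metric.closedBall (0 : StrongDual ℝ E) C) := by
    rw [Ultrafilter.coe_map, le_principal_iff, mem_map]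
    exact univ_mem' hmem
  obtain ⟨y, -, hy⟩ := hcpt.ultrafilter_le_nhds _ hle
  refine ⟨(InnerProductSpace.toDual ℝ E).symm (WeakDual.toStrongDual y), fun v => ?_⟩
  have h1 : Tendsto f U (𝓝 y) := by
    rwa [Ultrafilter.coe_map] at hy
  have h2 := ((WeakDual.eval_continuous v).tendsto y).comp h1
  rw [real_inner_comm, InnerProductSpace.toDual_symm_apply]
  refine h2.congr fun n => ?_
  rw [real_inner_comm, ← InnerProductSpace.toDual_apply_apply (𝕜 := ℝ)]
  rfl

/-- **Browder's demiclosedness principle** for nonexpansive operators. -/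
theorem eq_of_tendsto_inner_of_tendsto_sub {ι : Type*} {l : Filter ι} [l.NeBot] {T : E → E}
    (hT : ∀ x y, ‖T x - T y‖ ≤ ‖x - y‖) {x : ι → E} {y : E} {C : ℝ} (hC : ∀ n, ‖x n‖ ≤ C)
    (hy : ∀ v : E, Tendsto (fun n => (inner ℝ v (x n) : ℝ)) l (𝓝 (inner ℝ v y)))
    (hTx : Tendsto (fun n => ‖T (x n) - x n‖) l (𝓝 0)) : T y = y := by
  -- Expand `‖x n - T y‖²` around `y` and bound it through `T (x n)` by nonexpansiveness; the
  -- right-hand side tends to `0`.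
  have hbd : ∀ n, ‖y - T y‖ ^ 2 ≤ ‖T (x n) - x n‖ ^ 2 + 2 * ‖T (x n) - x n‖ * (C + ‖y‖) -
      2 * (inner ℝ (y - T y) (x n) - inner ℝ (y - T y) y) := by
    intro n
    have h1 : ‖x n - T y‖ ≤ ‖T (x n) - x n‖ + ‖x n - y‖ :=
      calc ‖x n - T y‖ ≤ ‖x n - T (x n)‖ + ‖T (x n) - T y‖ := norm_sub_le_norm_sub_add_norm_sub ..
        _ ≤ _ := add_le_add (norm_sub_rev _ _).le (hT _ _)
    have h2 : ‖x n - y‖ ≤ C + ‖y‖ := (norm_sub_le _ _).trans (by gcongr; exact hC n)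
    have h3 : ‖x n - T y‖ ^ 2 = ‖x n - y‖ ^ 2 + 2 * inner ℝ (x n - y) (y - T y) +
        ‖y - T y‖ ^ 2 := by
      rw [← norm_add_sq_real, sub_add_sub_cancel]
    rw [real_inner_comm, inner_sub_right] at h3
    have h4 : ‖x n - T y‖ ^ 2 ≤ (‖T (x n) - x n‖ + ‖x n - y‖) ^ 2 := by gcongr
    have h5 := mul_le_mul_of_nonneg_left h2 (norm_nonneg (T (x n) - x n))
    nlinarith
  have hlim := (((hTx.pow 2).add ((hTx.const_mul 2).mul_const (C + ‖y‖))).sub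
    (((hy (y - T y)).sub_const (inner ℝ (y - T y) y)).const_mul 2))
  have h0 := ge_of_tendsto' hlim hbd
  simp only [sub_self, mul_zero, zero_mul, add_zero, ne_eq, OfNat.ofNat_ne_zero, not_false_eq_true,
    zero_pow] at h0
  have h1 := le_antisymm h0 (sq_nonneg _)
  exact (sub_eq_zero.1 (by simpa using h1)).symm

/-- A form of **Opial's lemma** relative to the inner product `⟪L x, y⟫`: it suffices to know the
convergence of `⟪L (d - d'), x n⟫` for `d`, `d'` in a dense set of fixed points. -/
theorem exists_weaklyTendsto_fixedPoint [CompleteSpace E] {T : E → E}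
    (hT : ∀ x y, ‖T x - T y‖ ≤ ‖x - y‖) {x : ℕ → E} {C : ℝ} (hC : ∀ n, ‖x n‖ ≤ C)
    (hTx : Tendsto (fun n => ‖T (x n) - x n‖) atTop (𝓝 0))
    (L : E →L[ℝ] E) (hL : ∀ u, inner ℝ (L u) u = (0 : ℝ) → u = 0) {D : Set E}
    (hD : {y | T y = y} ⊆ closure D)
    (hconv : ∀ d ∈ D, ∀ d' ∈ D,
      ∃ l : ℝ, Tendsto (fun n => (inner ℝ (L (d - d')) (x n) : ℝ)) atTop (𝓝 l)) :
    ∃ y, T y = y ∧ WeaklyTendsto x y := by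
  have hcl : ∀ U : Ultrafilter ℕ, (U : Filter ℕ) ≤ atTop → ∃ y, T y = y ∧
      ∀ v : E, Tendsto (fun n => (inner ℝ v (x n) : ℝ)) U (𝓝 (inner ℝ v y)) := by
    intro U hU
    obtain ⟨y, hy⟩ := exists_tendsto_inner_of_ultrafilter U hC
    exact ⟨y, eq_of_tendsto_inner_of_tendsto_sub hT hC hy (hTx.mono_left hU), hy⟩
  obtain ⟨y, hTy, hy⟩ := hcl (Ultrafilter.of atTop) (Ultrafilter.of_le _)
  have huniq : ∀ U : Ultrafilter ℕ, (U : Filter ℕ) ≤ atTop → ∀ y', T y' = y' →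
      (∀ v : E, Tendsto (fun n => (inner ℝ v (x n) : ℝ)) U (𝓝 (inner ℝ v y'))) → y' = y := by
    intro U hU y' hTy' hy'
    have h1 : ∀ d ∈ D, ∀ d' ∈ D, inner ℝ (L (d - d')) (y' - y) = (0 : ℝ) := by
      intro d hd d' hd'
      obtain ⟨l, hl⟩ := hconv d hd d' hd'
      have e1 := tendsto_nhds_unique (hl.mono_left hU) (hy' _)
      have e2 := tendsto_nhds_unique (hl.mono_left (Ultrafilter.of_le _)) (hy _)
      rw [inner_sub_right, ← e1, ← e2, sub_self]
    -- Density is used in one argument at a time, replacing `d'` by `y` and then `d` by `y'`, until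
    -- definiteness of `L` applies to `y' - y`.
    have h2 : ∀ d ∈ D, inner ℝ (L (d - y)) (y' - y) = (0 : ℝ) := fun d hd =>
      closure_minimal (s := D) (t := {e | inner ℝ (L (d - e)) (y' - y) = (0 : ℝ)}) (h1 d hd)
        (isClosed_eq (by fun_prop) continuous_const) (hD hTy)
    exact sub_eq_zero.1 (hL _ (closure_minimal (s := D)
      (t := {e | inner ℝ (L (e - y)) (y' - y) = (0 : ℝ)}) h2
        (isClosed_eq (by fun_prop) continuous_const) (hD hTy')))
  refine ⟨y, hTy, (weaklyTendsto_iff_inner _ _).2 fun v => ?_⟩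
  refine (tendsto_iff_ultrafilter _ _ _).2 fun U hU => ?_
  obtain ⟨y', hTy', hy'⟩ := hcl U hU
  rw [← huniq U hU y' hTy' hy']
  exact hy' v

/-- Pettis's argument: separability makes closed balls countable intersections of half-spaces and
open sets countable unions of closed balls. -/
theorem measurable_of_forall_inner [TopologicalSpace.SeparableSpace E] [MeasurableSpace E]
    [BorelSpace E] {Ω : Type*} [MeasurableSpace Ω] {f : Ω → E}
    (hf : ∀ v : E, Measurable fun ω => (inner ℝ v (f ω) : ℝ)) : Measurable f := by
  set d : ℕ → E := TopologicalSpace.denseSeq E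
  have hd : DenseRange d := TopologicalSpace.denseRange_denseSeq E
  have hball : ∀ (c : E) (r : ℝ), 0 ≤ r → MeasurableSet (f ⁻¹' Metric.closedBall c r) := by
    intro c r hr
    have e : f ⁻¹' Metric.closedBall c r =
        ⋂ k, {ω | inner ℝ (d k) (f ω) - inner ℝ (d k) c ≤ r * ‖d k‖} := by
      ext ω
      simp only [Set.mem_preimage, mem_closedBall_iff_norm, Set.mem_iInter, Set.mem_ofPred_eq,
        ← inner_sub_right]
      constructor
      · intro h k
        calc inner ℝ (d k) (f ω - c) ≤ ‖d k‖ * ‖f ω - c‖ := real_inner_le_norm _ _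
          _ ≤ ‖d k‖ * r := by gcongr
          _ = _ := mul_comm _ _
      · intro h
        have h1 : inner ℝ (f ω - c) (f ω - c) ≤ r * ‖f ω - c‖ :=
          hd.induction_on (p := fun v => inner ℝ v (f ω - c) ≤ r * ‖v‖) _
            (isClosed_le (by fun_prop) (by fun_prop)) h
        rw [real_inner_self_eq_norm_sq, sq] at h1
        rcases (norm_nonneg (f ω - c)).eq_or_lt with h0 | h0
        · rwa [← h0]
        · exact le_of_mul_le_mul_right h1 h0
    rw [e]
    exact MeasurableSet.iInter fun k => measurableSet_le ((hf _).sub_const _) measurable_const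
  refine measurable_of_isOpen fun s hs => ?_
  have e : f ⁻¹' s = ⋃ (k : ℕ) (n : ℕ) (_ : Metric.closedBall (d k) (1 / ((n : ℝ) + 1)) ⊆ s),
      f ⁻¹' Metric.closedBall (d k) (1 / ((n : ℝ) + 1)) := by
    ext ω
    simp only [Set.mem_preimage, Set.mem_iUnion, exists_prop]
    constructor
    · intro hω
      obtain ⟨r, hr, hrs⟩ := Metric.isOpen_iff.1 hs _ hω
      obtain ⟨n, hn⟩ := exists_nat_one_div_lt (half_pos hr)
      obtain ⟨k, hk⟩ := hd.exists_dist_lt (f ω) (Nat.one_div_pos_of_nat (α := ℝ) (n := n))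
      refine ⟨k, n, fun y hy => hrs ?_, hk.le⟩
      have := dist_triangle_right y (f ω) (d k)
      rw [Metric.mem_closedBall] at hy
      rw [Metric.mem_ball]
      linarith
    · rintro ⟨k, n, h, hω⟩
      exact h hω
  rw [e]
  exact MeasurableSet.iUnion fun k => MeasurableSet.iUnion fun n => MeasurableSet.iUnion
    fun _ => hball _ _ (by positivity)

end WeakConvergence

/-! ### Fixed points of the Douglas–Rachford operator and primal-dual solutions -/

section Splitting

variable {m : ℕ} {H : Fin m → Type*}

/-- The map acting as `J i` on the `i`-th summand of the direct Hilbert sum. -/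
def blockMap (J : ∀ i, H i → H i) (x : PiLp 2 H) : PiLp 2 H := WithLp.toLp 2 fun i => J i (x i)

@[simp] theorem blockMap_apply (J : ∀ i, H i → H i) (x : PiLp 2 H) (i : Fin m) :
    blockMap J x i = J i (x i) := rfl

variable [∀ i, NormedAddCommGroup (H i)] [∀ i, InnerProductSpace ℝ (H i)]

theorem isFirmlyNonexpansive_blockMap {J : ∀ i, H i → H i}
    (hJ : ∀ i, IsFirmlyNonexpansive (J i)) : IsFirmlyNonexpansive (blockMap J) := by
  intro x y
  rw [PiLp.norm_sq_eq_of_L2, PiLp.inner_apply]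
  exact Finset.sum_le_sum fun i _ => hJ i (x i) (y i)

variable [∀ i, CompleteSpace (H i)] {A : ∀ i, H i → Set (H i)}
  {B : PiLp 2 H → Set (PiLp 2 H)} {γ : ℝ}

/-- With `z = Q x` and `u = γ⁻¹(x - z)`, being fixed means `J_A(2z - x) = z`, that is `-u ∈ A z`.
Since `u ∈ B z` always holds, this one inclusion encodes both problems. -/
theorem drOp_eq_self_iff (hA : ∀ i, IsMaximallyMonotone (A i)) (hγ : 0 < γ) {x : PiLp 2 H} :
    drOp (blockMap fun i => resolventMap fun y => γ • A i y) (resolventMap fun y => γ • B y) x = x ↔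
      ∀ i, (-(γ⁻¹ • (x - resolventMap (fun y => γ • B y) x)) : PiLp 2 H) i ∈
        A i (resolventMap (fun y => γ • B y) x i) := by
  set z := resolventMap (fun y => γ • B y) x with hz
  have h1 : drOp (blockMap fun i => resolventMap fun y => γ • A i y)
      (resolventMap fun y => γ • B y) x = x ↔
      blockMap (fun i => resolventMap fun y => γ • A i y) ((2 : ℝ) • z - x) = z := by
    rw [drOp, ← hz, add_sub_assoc, add_eq_left, sub_eq_zero]
  rw [h1, PiLp.ext_iff]
  refine forall_congr' fun i => ?_
  rw [blockMap_apply, resolventMap_smul_eq_iff (hA i) hγ]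
  have : γ⁻¹ • (((2 : ℝ) • z - x) i - z i) = -(γ⁻¹ • (x - z)) i := by
    simp only [PiLp.sub_apply, PiLp.smul_apply]
    module
  rw [this, PiLp.neg_apply]

theorem resolventMap_mem_primalSolutions (hA : ∀ i, IsMaximallyMonotone (A i))
    (hB : IsMaximallyMonotone B) (hγ : 0 < γ) {x : PiLp 2 H}
    (hx : drOp (blockMap fun i => resolventMap fun y => γ • A i y)
      (resolventMap fun y => γ • B y) x = x) :
    resolventMap (fun y => γ • B y) x ∈ primalSolutions A B := by
  refine Set.mem_add.2 ⟨_, fun i => (drOp_eq_self_iff hA hγ).1 hx i, _,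
    (resolventMap_smul_eq_iff hB hγ).1 rfl, ?_⟩
  exact neg_add_cancel _

theorem smul_sub_resolventMap_mem_dualSolutions (hA : ∀ i, IsMaximallyMonotone (A i))
    (hB : IsMaximallyMonotone B) (hγ : 0 < γ) {x : PiLp 2 H}
    (hx : drOp (blockMap fun i => resolventMap fun y => γ • A i y)
      (resolventMap fun y => γ • B y) x = x) :
    γ⁻¹ • (x - resolventMap (fun y => γ • B y) x) ∈ dualSolutions A B := by
  refine Set.mem_add.2 ⟨-resolventMap (fun y => γ • B y) x, ?_, resolventMap (fun y => γ • B y) x,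
    (resolventMap_smul_eq_iff hB hγ).1 rfl, neg_add_cancel _⟩
  rw [Set.neg_mem_neg]
  exact fun i => (drOp_eq_self_iff hA hγ).1 hx i

theorem exists_drOp_eq_self (hA : ∀ i, IsMaximallyMonotone (A i))
    (hB : IsMaximallyMonotone B) (hγ : 0 < γ) (hF : (primalSolutions A B).Nonempty) :
    ∃ x, drOp (blockMap fun i => resolventMap fun y => γ • A i y)
      (resolventMap fun y => γ • B y) x = x := by
  obtain ⟨y, v, hv, u, hu, hvu⟩ := hF
  have hres : resolventMap (fun y => γ • B y) (y + γ • u) = y := by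
    rw [resolventMap_smul_eq_iff hB hγ, add_sub_cancel_left, inv_smul_smul₀ hγ.ne']
    exact hu
  -- The witness is chosen so that `Q` returns `y` and the associated dual vector is `u`.
  refine ⟨y + γ • u, (drOp_eq_self_iff hA hγ).2 fun i => ?_⟩
  rw [hres, add_sub_cancel_left, inv_smul_smul₀ hγ.ne',
    ← eq_neg_of_add_eq_zero_left hvu]
  exact hv i

end Splitting

/-! ### Integration over an independent activation -/

section Indep

variable {Ω : Type*} {mΩ : MeasurableSpace Ω} {P : Measure Ω}

theorem lintegral_ite_of_indep [IsProbabilityMeasure P] {M F : MeasurableSpace Ω} (hM : M ≤ mΩ)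
    (hF : F ≤ mΩ) (hind : Indep M F P) {s : Set Ω} [DecidablePred (· ∈ s)]
    (hs : MeasurableSet[M] s) {f g : Ω → ℝ≥0∞} (hf : Measurable[F] f) (hg : Measurable[F] g) :
    ∫⁻ ω, (if ω ∈ s then f ω else g ω) ∂P =
      ∫⁻ ω, ENNReal.ofReal (P.real s) * f ω + ENNReal.ofReal (1 - P.real s) * g ω ∂P := by
  have hs' : MeasurableSet[mΩ] s := hM s hs
  have hf' : Measurable[mΩ] f := hf.mono hF le_rfl
  have hg' : Measurable[mΩ] g := hg.mono hF le_rfl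
  have hkey : ∀ {t : Set Ω} {h : Ω → ℝ≥0∞}, MeasurableSet[M] t → Measurable[F] h →
      ∫⁻ ω in t, h ω ∂P = ENNReal.ofReal (P.real t) * ∫⁻ ω, h ω ∂P := by
    intro t h ht hh
    have h1 := lintegral_mul_eq_lintegral_mul_lintegral_of_independent_measurableSpace hM hF hind
      (f := t.indicator fun _ => 1) (Measurable.indicator measurable_const ht) hh
    rw [lintegral_indicator_const (hM t ht), one_mul] at h1
    rw [ofReal_measureReal, ← h1, ← lintegral_indicator (hM t ht)]
    refine lintegral_congr fun ω => ?_
    by_cases hω : ω ∈ t <;> simp [hω]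
  rw [lintegral_add_left (hf'.const_mul _), lintegral_const_mul _ hf', lintegral_const_mul _ hg',
    ← hkey hs hf, ← probReal_compl_eq_one_sub hs', ← hkey hs.compl hg,
    ← lintegral_add_compl _ hs']
  congr 1
  · exact setLIntegral_congr_fun hs' fun ω hω => if_pos hω
  · exact setLIntegral_congr_fun hs'.compl fun ω hω => if_neg hω

end Indep

/-! ### The conditional one-step inequality in the weighted norm -/

section OneStep

theorem norm_add_sq_le_young {E : Type*} [NormedAddCommGroup E] [InnerProductSpace ℝ E] (u v : E)
    {α : ℝ} (hα : 0 < α) :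
    ‖u + v‖ ^ 2 ≤ (1 + α) * ‖u‖ ^ 2 + (1 + α⁻¹) * ‖v‖ ^ 2 := by
  have h1 : ‖u + v‖ ^ 2 ≤ (‖u‖ + ‖v‖) ^ 2 := by gcongr; exact norm_add_le u v
  have h2 : 0 ≤ α⁻¹ * (α * ‖u‖ - ‖v‖) ^ 2 := by positivity
  have h3 : α⁻¹ * (α * ‖u‖ - ‖v‖) ^ 2 = α * ‖u‖ ^ 2 - 2 * ‖u‖ * ‖v‖ + α⁻¹ * ‖v‖ ^ 2 := by
    field_simp
    ring
  nlinarith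

variable {m : ℕ} {H : Fin m → Type*} [∀ i, NormedAddCommGroup (H i)]

/-- The square of the weighted norm `(∑ wᵢ ‖xᵢ‖²)^(1/2)`. -/
def weightedNormSq (w : Fin m → ℝ) (x : PiLp 2 H) : ℝ := ∑ i, w i * ‖x i‖ ^ 2

theorem weightedNormSq_nonneg {w : Fin m → ℝ} (hw : ∀ i, 0 ≤ w i) (x : PiLp 2 H) :
    0 ≤ weightedNormSq w x :=
  Finset.sum_nonneg fun i _ => mul_nonneg (hw i) (sq_nonneg _)

theorem continuous_weightedNormSq (w : Fin m → ℝ) :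
    Continuous (weightedNormSq w : PiLp 2 H → ℝ) := by
  unfold weightedNormSq
  fun_prop

theorem weightedNormSq_le {w : Fin m → ℝ} (hw : ∀ i, 0 ≤ w i) (x : PiLp 2 H) :
    weightedNormSq w x ≤ (∑ i, w i) * ‖x‖ ^ 2 := by
  rw [weightedNormSq, PiLp.norm_sq_eq_of_L2, Finset.sum_mul]
  refine Finset.sum_le_sum fun i _ => mul_le_mul_of_nonneg_left ?_ (hw i)
  exact Finset.single_le_sum (f := fun j => ‖x j‖ ^ 2) (fun j _ => sq_nonneg _) (Finset.mem_univ i)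

theorem norm_sq_le_weightedNormSq {w : Fin m → ℝ} (hw : ∀ i, 1 ≤ w i) (x : PiLp 2 H) :
    ‖x‖ ^ 2 ≤ weightedNormSq w x := by
  rw [PiLp.norm_sq_eq_of_L2, weightedNormSq]
  exact Finset.sum_le_sum fun i _ => le_mul_of_one_le_left (sq_nonneg _) (hw i)

theorem fin_two_eq_one_or_eq_zero (k : Fin 2) : k = 1 ∨ k = 0 := by
  fin_cases k <;> simp

variable [∀ i, InnerProductSpace ℝ (H i)]

/-- The error is charged to all blocks, active or not, so its term does not involve `s`; hence no
independence between errors and activations is needed later. The factor 4 bounds `μ²`. -/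
theorem weightedNormSq_step_le {w : Fin m → ℝ} (hw : ∀ i, 0 ≤ w i) {x x' t e y : PiLp 2 H}
    {s : Fin m → Fin 2} {μ α : ℝ} (hμ0 : 0 ≤ μ) (hμ2 : μ ≤ 2) (hα : 0 < α)
    (hx' : ∀ i, x' i = x i + (((s i : ℕ) : ℝ) * μ) • (t i + e i - x i)) :
    weightedNormSq w (x' - y) ≤
      (∑ i, (1 + α) * (w i * if s i = 1 then ‖(x + μ • (t - x) - y) i‖ ^ 2 else ‖(x - y) i‖ ^ 2)) +
        (1 + α⁻¹) * (4 * (∑ i, w i)) * ‖e‖ ^ 2 := by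
  have h1 : ∀ i, w i * ‖(x' - y) i‖ ^ 2 ≤
      (1 + α) * (w i * if s i = 1 then ‖(x + μ • (t - x) - y) i‖ ^ 2 else ‖(x - y) i‖ ^ 2) +
        (1 + α⁻¹) * 4 * (w i * ‖e i‖ ^ 2) := by
    intro i
    have hα' : 0 < α⁻¹ := inv_pos.2 hα
    rcases fin_two_eq_one_or_eq_zero (s i) with h | h
    · have e1 : (x' - y) i = (x + μ • (t - x) - y) i + μ • e i := by
        simp only [PiLp.sub_apply, PiLp.add_apply, PiLp.smul_apply, hx', h, Fin.val_one,
          Nat.cast_one]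
        module
      have h2 := norm_add_sq_le_young ((x + μ • (t - x) - y) i) (μ • e i) hα
      rw [if_pos h, e1]
      have h3 : ‖μ • e i‖ ^ 2 ≤ 4 * ‖e i‖ ^ 2 := by
        rw [norm_smul, mul_pow, Real.norm_eq_abs, sq_abs]
        gcongr
        nlinarith
      calc _ ≤ w i * ((1 + α) * ‖(x + μ • (t - x) - y) i‖ ^ 2 + (1 + α⁻¹) * (4 * ‖e i‖ ^ 2)) := by
            refine mul_le_mul_of_nonneg_left (h2.trans ?_) (hw i)
            gcongr
        _ = _ := by ring
    · have e1 : (x' - y) i = (x - y) i := by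
        simp [PiLp.sub_apply, hx', h]
      have h2 : 0 ≤ α * (w i * ‖(x - y) i‖ ^ 2) :=
        mul_nonneg hα.le (mul_nonneg (hw i) (sq_nonneg _))
      have h3 : 0 ≤ (1 + α⁻¹) * 4 * (w i * ‖e i‖ ^ 2) :=
        mul_nonneg (by positivity) (mul_nonneg (hw i) (sq_nonneg _))
      rw [if_neg (by simp [h]), e1]
      linarith
  refine (Finset.sum_le_sum fun i _ => h1 i).trans ?_
  have h2 : (1 + α⁻¹) * 4 * weightedNormSq w e ≤ (1 + α⁻¹) * 4 * ((∑ i, w i) * ‖e‖ ^ 2) := by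
    gcongr
    exact weightedNormSq_le hw e
  rw [Finset.sum_add_distrib, ← Finset.mul_sum _ _ ((1 + α⁻¹) * 4)]
  rw [weightedNormSq] at h2
  linarith

variable [∀ i, MeasurableSpace (H i)] [∀ i, BorelSpace (H i)]
  [∀ i, SecondCountableTopology (H i)] {Ω : Type*} {mΩ : MeasurableSpace Ω} {P : Measure Ω}

/-- The conditional one-step inequality of block-coordinate Krasnoselskii–Mann iterations, tested
against a nonnegative weight `g`. -/
theorem lintegral_step_le [IsProbabilityMeasure P] {F : MeasurableSpace Ω} (hF : F ≤ mΩ)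
    {ε : Ω → Selection m} (hε : Measurable[mΩ] ε)
    (hind : Indep (MeasurableSpace.comap ε inferInstance) F P)
    {p : Fin m → ℝ} (hp0 : ∀ i, 0 < p i) (hp : ∀ i, P.real {ω | (ε ω).1 i = 1} = p i)
    {x x' e a b : Ω → PiLp 2 H} (hx : Measurable[F] x) (ha : Measurable[mΩ] a)
    (hb : Measurable[mΩ] b) {T : PiLp 2 H → PiLp 2 H} (hT : IsFirmlyNonexpansive T)
    {y : PiLp 2 H} (hy : T y = y) {μ : ℝ} (hμ : μ ∈ Set.Ioo (0 : ℝ) 2) {K : ℝ} (hK : 0 ≤ K)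
    (he : ∀ ω, ‖e ω‖ ^ 2 ≤ K * (‖a ω‖ ^ 2 + ‖b ω‖ ^ 2))
    (hx' : ∀ ω i, x' ω i = x ω i + ((((ε ω).1 i : ℕ) : ℝ) * μ) • (T (x ω) i + e ω i - x ω i))
    {α : Ω → ℝ} (hα : Measurable[F] α) (hα0 : ∀ ω, 0 < α ω)
    (hdom : ∀ᵐ ω ∂P, condLExp F P (fun ω' => ‖a ω'‖ₑ ^ 2) ω +
      condLExp F P (fun ω' => ‖b ω'‖ₑ ^ 2) ω ≤ ENNReal.ofReal (α ω ^ 2))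
    {g : Ω → ℝ≥0∞} (hg : Measurable[F] g) :
    ∫⁻ ω, g ω * ENNReal.ofReal (weightedNormSq (fun i => (p i)⁻¹) (x' ω - y) +
        μ * (2 - μ) * ‖T (x ω) - x ω‖ ^ 2) ∂P ≤
      ∫⁻ ω, g ω * ENNReal.ofReal ((1 + α ω) * weightedNormSq (fun i => (p i)⁻¹) (x ω - y) +
        4 * (∑ i, (p i)⁻¹) * K * (α ω ^ 2 + α ω)) ∂P := by
  classical
  have hw : ∀ i, 0 ≤ (p i)⁻¹ := fun i => (inv_pos.2 (hp0 i)).le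
  have hW : 0 ≤ ∑ i, (p i)⁻¹ := Finset.sum_nonneg fun i _ => hw i
  have hp1 : ∀ i, p i ≤ 1 := fun i => hp i ▸ measureReal_le_one
  have hTc : Continuous T := hT.continuous
  set c : Ω → ℝ := fun ω => (1 + (α ω)⁻¹) * (4 * (∑ i, (p i)⁻¹)) * K with hc
  have hc0 : ∀ ω, 0 ≤ c ω := fun ω => by have := hα0 ω; positivity
  set η : Ω → ℝ := fun ω => μ * (2 - μ) * ‖T (x ω) - x ω‖ ^ 2 with hη
  have hη0 : ∀ ω, 0 ≤ η ω := fun ω =>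
    mul_nonneg (mul_nonneg hμ.1.le (sub_nonneg.2 hμ.2.le)) (sq_nonneg _)
  set u : Fin m → Ω → ℝ := fun i ω => (1 + α ω) * ((p i)⁻¹ * ‖(x ω - y) i‖ ^ 2) with hu
  set v : Fin m → Ω → ℝ := fun i ω =>
    (1 + α ω) * ((p i)⁻¹ * ‖(x ω + μ • (T (x ω) - x ω) - y) i‖ ^ 2) with hv
  have hu0 : ∀ i ω, 0 ≤ u i ω := fun i ω => by
    have := hα0 ω
    have := hw i
    positivity
  have hv0 : ∀ i ω, 0 ≤ v i ω := fun i ω => by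
    have := hα0 ω
    have := hw i
    positivity
  have hcm : Measurable[F] c := ((hα.inv.const_add 1).mul_const _).mul_const _
  have hηm : Measurable[F] η :=
    (show Continuous fun z => μ * (2 - μ) * ‖T z - z‖ ^ 2 by fun_prop).measurable.comp hx
  have hum : ∀ i, Measurable[F] (u i) := fun i => (hα.const_add 1).mul
    ((show Continuous fun z : PiLp 2 H => (p i)⁻¹ * ‖(z - y) i‖ ^ 2 by fun_prop).measurable.comp hx)
  have hvm : ∀ i, Measurable[F] (v i) := fun i => (hα.const_add 1).mul
    ((show Continuous fun z : PiLp 2 H => (p i)⁻¹ * ‖(z + μ • (T z - z) - y) i‖ ^ 2 by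
      fun_prop).measurable.comp hx)
  have hsel : ∀ i, MeasurableSet[MeasurableSpace.comap ε inferInstance] {ω | (ε ω).1 i = 1} :=
    fun i => ⟨{e | e.1 i = 1}, MeasurableSet.of_discrete, rfl⟩
  have hgU : ∀ i, Measurable[F] fun ω => g ω * ENNReal.ofReal (u i ω) := fun i =>
    hg.mul (hum i).ennreal_ofReal
  have hgV : ∀ i, Measurable[F] fun ω => g ω * ENNReal.ofReal (v i ω) := fun i =>
    hg.mul (hvm i).ennreal_ofReal
  have hgE : Measurable[F] fun ω => g ω * ENNReal.ofReal (η ω) := hg.mul hηm.ennreal_ofReal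
  have hgC : Measurable[F] fun ω => g ω * ENNReal.ofReal (c ω) := hg.mul hcm.ennreal_ofReal
  have ha2 : Measurable[mΩ] fun ω => ‖a ω‖ₑ ^ 2 := 
    (show Continuous fun z : PiLp 2 H => ‖z‖ₑ ^ 2 by fun_prop).measurable.comp ha
  have hb2 : Measurable[mΩ] fun ω => ‖b ω‖ₑ ^ 2 := 
    (show Continuous fun z : PiLp 2 H => ‖z‖ₑ ^ 2 by fun_prop).measurable.comp hb
  have hgA : Measurable[mΩ] fun ω => g ω * ENNReal.ofReal (c ω) * ‖a ω‖ₑ ^ 2 :=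
    (hgC.mono hF le_rfl).mul ha2
  have hgB : Measurable[mΩ] fun ω => g ω * ENNReal.ofReal (c ω) * ‖b ω‖ₑ ^ 2 :=
    (hgC.mono hF le_rfl).mul hb2
  have hgAB : Measurable[mΩ] fun ω => g ω * ENNReal.ofReal (c ω) * ‖a ω‖ₑ ^ 2 +
      g ω * ENNReal.ofReal (c ω) * ‖b ω‖ₑ ^ 2 := hgA.add hgB
  have hite : ∀ i, Measurable[mΩ] fun ω => if ω ∈ {ω | (ε ω).1 i = 1} then
      g ω * ENNReal.ofReal (v i ω) else g ω * ENNReal.ofReal (u i ω) := fun i =>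
    Measurable.ite (hε.comap_le _ (hsel i)) ((hgV i).mono hF le_rfl) ((hgU i).mono hF le_rfl)
  calc _ ≤ ∫⁻ ω, ((∑ i, if ω ∈ {ω | (ε ω).1 i = 1} then g ω * ENNReal.ofReal (v i ω) else
              g ω * ENNReal.ofReal (u i ω)) + g ω * ENNReal.ofReal (η ω)) +
            (g ω * ENNReal.ofReal (c ω) * ‖a ω‖ₑ ^ 2 + g ω * ENNReal.ofReal (c ω) * ‖b ω‖ₑ ^ 2)
            ∂P := by
        refine lintegral_mono fun ω => ?_
        have h1 := weightedNormSq_step_le (y := y) hw hμ.1.le hμ.2.le (hα0 ω) (hx' ω)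
        have h2 : (1 + (α ω)⁻¹) * (4 * (∑ i, (p i)⁻¹)) * ‖e ω‖ ^ 2 ≤
            c ω * ‖a ω‖ ^ 2 + c ω * ‖b ω‖ ^ 2 := by
          have := hα0 ω
          calc _ ≤ (1 + (α ω)⁻¹) * (4 * (∑ i, (p i)⁻¹)) * (K * (‖a ω‖ ^ 2 + ‖b ω‖ ^ 2)) := by
                gcongr
                exact he ω
            _ = _ := by simp only [hc]; ring
        have h3 : (∑ i, (1 + α ω) * ((p i)⁻¹ * if (ε ω).1 i = 1 then
            ‖(x ω + μ • (T (x ω) - x ω) - y) i‖ ^ 2 else ‖(x ω - y) i‖ ^ 2)) =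
            ∑ i, if (ε ω).1 i = 1 then v i ω else u i ω :=
          Finset.sum_congr rfl fun i _ => by split_ifs <;> rfl
        have h4 : ∀ i, 0 ≤ if (ε ω).1 i = 1 then v i ω else u i ω := fun i => by
          split_ifs
          exacts [hv0 i ω, hu0 i ω]
        have h5 : ∀ z : PiLp 2 H, ‖z‖ₑ ^ 2 = ENNReal.ofReal (‖z‖ ^ 2) := fun z => by
          rw [ENNReal.ofReal_pow (norm_nonneg _), ofReal_norm]
        have h6 : (∑ i, if ω ∈ {ω | (ε ω).1 i = 1} then g ω * ENNReal.ofReal (v i ω) else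
            g ω * ENNReal.ofReal (u i ω)) =
            g ω * ENNReal.ofReal (∑ i, if (ε ω).1 i = 1 then v i ω else u i ω) := by
          rw [ENNReal.ofReal_sum_of_nonneg fun i _ => h4 i, Finset.mul_sum]
          refine Finset.sum_congr rfl fun i _ => ?_
          simp only [Set.mem_ofPred_eq]
          split_ifs <;> rfl
        have h7 := hc0 ω
        have h8 := hη0 ω
        have h9 : 0 ≤ ∑ i, if (ε ω).1 i = 1 then v i ω else u i ω :=
          Finset.sum_nonneg fun i _ => h4 i
        rw [h6, h5, h5, mul_assoc (g ω), mul_assoc (g ω), ← ENNReal.ofReal_mul h7,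
          ← ENNReal.ofReal_mul h7,
          ← mul_add, ← mul_add, ← mul_add, ← ENNReal.ofReal_add h9 h8,
          ← ENNReal.ofReal_add (by positivity) (by positivity),
          ← ENNReal.ofReal_add (by positivity) (by positivity)]
        refine mul_le_mul' le_rfl (ENNReal.ofReal_le_ofReal ?_)
        rw [h3] at h1
        simp only [hη]
        linarith
    -- Independence averages the activations in the terms depending on `x` alone; the errors are
    -- merely conditioned on `F`.
    _ = (∑ i, ∫⁻ ω, (ENNReal.ofReal (p i) * (g ω * ENNReal.ofReal (v i ω)) +
            ENNReal.ofReal (1 - p i) * (g ω * ENNReal.ofReal (u i ω))) ∂P) +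
          ∫⁻ ω, g ω * ENNReal.ofReal (η ω) ∂P +
          (∫⁻ ω, g ω * ENNReal.ofReal (c ω) * condLExp F P (fun ω' => ‖a ω'‖ₑ ^ 2) ω ∂P +
            ∫⁻ ω, g ω * ENNReal.ofReal (c ω) * condLExp F P (fun ω' => ‖b ω'‖ₑ ^ 2) ω ∂P) := by
        rw [lintegral_add_right _ hgAB, lintegral_add_right _ (hgE.mono hF le_rfl),
          lintegral_finsetSum _ fun i _ => hite i,
          lintegral_add_right _ hgB, lintegral_mul_condLExp hF ha2 hgC,
          lintegral_mul_condLExp hF hb2 hgC]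
        congr 2
        refine Finset.sum_congr rfl fun i _ => ?_
        rw [lintegral_ite_of_indep hε.comap_le hF hind (hsel i) (hgV i) (hgU i), hp]
    _ = ∫⁻ ω, ((∑ i, (ENNReal.ofReal (p i) * (g ω * ENNReal.ofReal (v i ω)) +
            ENNReal.ofReal (1 - p i) * (g ω * ENNReal.ofReal (u i ω)))) +
          g ω * ENNReal.ofReal (η ω)) + g ω * ENNReal.ofReal (c ω) *
            (condLExp F P (fun ω' => ‖a ω'‖ₑ ^ 2) ω + condLExp F P (fun ω' => ‖b ω'‖ₑ ^ 2) ω)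
            ∂P := by
        have hA : Measurable[mΩ] (condLExp F P fun ω' => ‖a ω'‖ₑ ^ 2) :=
          (measurable_condLExp F P _).mono hF le_rfl
        have hB : Measurable[mΩ] (condLExp F P fun ω' => ‖b ω'‖ₑ ^ 2) :=
          (measurable_condLExp F P _).mono hF le_rfl
        have hgcA : Measurable[mΩ] fun ω => g ω * ENNReal.ofReal (c ω) *
            condLExp F P (fun ω' => ‖a ω'‖ₑ ^ 2) ω := (hgC.mono hF le_rfl).mul hA
        have hgcB : Measurable[mΩ] fun ω => g ω * ENNReal.ofReal (c ω) *
            condLExp F P (fun ω' => ‖b ω'‖ₑ ^ 2) ω := (hgC.mono hF le_rfl).mul hB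
        have hgcAB : Measurable[mΩ] fun ω => g ω * ENNReal.ofReal (c ω) *
            condLExp F P (fun ω' => ‖a ω'‖ₑ ^ 2) ω + g ω * ENNReal.ofReal (c ω) *
            condLExp F P (fun ω' => ‖b ω'‖ₑ ^ 2) ω := hgcA.add hgcB
        have hgUV : ∀ i, Measurable[mΩ] fun ω =>
            ENNReal.ofReal (p i) * (g ω * ENNReal.ofReal (v i ω)) +
              ENNReal.ofReal (1 - p i) * (g ω * ENNReal.ofReal (u i ω)) := fun i =>
          (((hgV i).mono hF le_rfl).const_mul _).add (((hgU i).mono hF le_rfl).const_mul _)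
        simp only [mul_add]
        rw [lintegral_add_right _ hgcAB, lintegral_add_right _ (hgE.mono hF le_rfl),
          lintegral_finsetSum _ fun i _ => hgUV i,
          lintegral_add_right _ hgcB]
    _ ≤ _ := by
        refine lintegral_mono_ae ?_
        filter_upwards [hdom] with ω hω
        have hα' := hα0 ω
        have h7 := hc0 ω
        have h8 := hη0 ω
        have h1 : ∀ i, ENNReal.ofReal (p i) * (g ω * ENNReal.ofReal (v i ω)) +
            ENNReal.ofReal (1 - p i) * (g ω * ENNReal.ofReal (u i ω)) =
            g ω * ENNReal.ofReal (p i * v i ω + (1 - p i) * u i ω) := by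
          intro i
          have := hp1 i
          rw [ENNReal.ofReal_add (mul_nonneg (hp0 i).le (hv0 i ω))
            (mul_nonneg (by linarith) (hu0 i ω)), ENNReal.ofReal_mul (hp0 i).le,
            ENNReal.ofReal_mul (show 0 ≤ 1 - p i by linarith)]
          ring
        have h2 : ∀ i, 0 ≤ p i * v i ω + (1 - p i) * u i ω := fun i => by
          have := hp1 i
          exact add_nonneg (mul_nonneg (hp0 i).le (hv0 i ω)) (mul_nonneg (by linarith) (hu0 i ω))
        -- The weights `1/pᵢ` are chosen for this cancellation: the averaged progress becomes
        -- unweighted, where the Fejér inequality for `T` holds.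
        have h3 : ∑ i, (p i * v i ω + (1 - p i) * u i ω) =
            (1 + α ω) * (‖x ω + μ • (T (x ω) - x ω) - y‖ ^ 2 - ‖x ω - y‖ ^ 2 +
              weightedNormSq (fun i => (p i)⁻¹) (x ω - y)) := by
          rw [PiLp.norm_sq_eq_of_L2, PiLp.norm_sq_eq_of_L2, weightedNormSq,
            ← Finset.sum_sub_distrib, ← Finset.sum_add_distrib, Finset.mul_sum]
          refine Finset.sum_congr rfl fun i _ => ?_
          have := (hp0 i).ne'
          simp only [hu, hv]
          field_simp
          ring
        have h4 := hT.norm_relaxation_sq_le (x ω) hy hμ.1.le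
        -- Young's coefficient `1 + α⁻¹` times a conditional error of order `α²` leaves `α² + α`,
        -- which is summable along with `α`.
        have h5 : c ω * α ω ^ 2 = 4 * (∑ i, (p i)⁻¹) * K * (α ω ^ 2 + α ω) := by
          simp only [hc]
          field_simp
        calc _ ≤ (∑ i, g ω * ENNReal.ofReal (p i * v i ω + (1 - p i) * u i ω)) +
              g ω * ENNReal.ofReal (η ω) +
              g ω * ENNReal.ofReal (c ω) * ENNReal.ofReal (α ω ^ 2) := by
              simp only [h1]
              gcongr
          _ = g ω * ENNReal.ofReal ((∑ i, (p i * v i ω + (1 - p i) * u i ω)) + η ω +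
              c ω * α ω ^ 2) := by
              rw [← Finset.mul_sum, ← ENNReal.ofReal_sum_of_nonneg fun i _ => h2 i, mul_assoc,
                ← ENNReal.ofReal_mul h7, ← mul_add, ← mul_add, ← ENNReal.ofReal_add
                (Finset.sum_nonneg fun i _ => h2 i) h8, ← ENNReal.ofReal_add
                (add_nonneg (Finset.sum_nonneg fun i _ => h2 i) h8) (by positivity)]
          _ ≤ _ := by
              refine mul_le_mul' le_rfl (ENNReal.ofReal_le_ofReal ?_)
              rw [h3, h5]
              have h6 := mul_le_mul_of_nonneg_left h4 (by linarith : 0 ≤ 1 + α ω)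
              -- The descent term carries the factor `1 + α`; the surplus `α η` is discarded.
              have h9 := mul_nonneg hα'.le h8
              simp only [hη] at h9 ⊢
              linarith

end OneStep

/-! ### Block-coordinate Krasnoselskii–Mann iterations -/

section KrasnoselskiiMann

/-- The filtration generated by a measurable process. -/
def historyFiltration {Ω E : Type*} {mΩ : MeasurableSpace Ω} [MeasurableSpace E] {x : ℕ → Ω → E}
    (hx : ∀ n, Measurable (x n)) : Filtration ℕ mΩ where
  seq := history x
  mono' _ _ hij := biSup_mono fun _ => ge_trans hij
  le' _ := iSup₂_le fun k _ => (hx k).comap_le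

theorem measurable_history {Ω E : Type*} [MeasurableSpace E] (x : ℕ → Ω → E) (n : ℕ) :
    Measurable[history x n] (x n) :=
  measurable_iff_comap_le.2 (le_iSup₂_of_le n le_rfl le_rfl)

variable {m : ℕ} {H : Fin m → Type*} [∀ i, NormedAddCommGroup (H i)]
  [∀ i, InnerProductSpace ℝ (H i)]

/-- The diagonal operator `x ↦ (wᵢ xᵢ)ᵢ` on the direct Hilbert sum. -/
def diagCLM (w : Fin m → ℝ) : PiLp 2 H →L[ℝ] PiLp 2 H where
  toFun x := WithLp.toLp 2 fun i => w i • x i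
  map_add' x y := by ext i; simp
  map_smul' c x := by ext i; simp [smul_comm (w i) c]
  cont := by fun_prop

theorem inner_diagCLM (w : Fin m → ℝ) (x y : PiLp 2 H) :
    inner ℝ (diagCLM w x) y = ∑ i, w i * inner ℝ (x i) (y i) := by
  simp [PiLp.inner_apply, diagCLM, inner_smul_left]

theorem inner_diagCLM_self (w : Fin m → ℝ) (x : PiLp 2 H) :
    inner ℝ (diagCLM w x) x = weightedNormSq w x := by
  simp [inner_diagCLM, weightedNormSq]

/-- The quadratic terms in `x` cancel, so convergence of weighted distances gives convergence of the
inner products required by the Opial argument. -/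
theorem weightedNormSq_sub_sub_weightedNormSq_sub (w : Fin m → ℝ) (x d d' : PiLp 2 H) :
    weightedNormSq w (x - d) - weightedNormSq w (x - d') =
      weightedNormSq w d - weightedNormSq w d' - 2 * inner ℝ (diagCLM w (d - d')) x := by
  rw [inner_diagCLM]
  simp only [weightedNormSq, ← Finset.sum_sub_distrib, Finset.mul_sum]
  refine Finset.sum_congr rfl fun i _ => ?_
  simp only [PiLp.sub_apply, norm_sub_sq_real, inner_sub_right, real_inner_comm (x i)]
  ring

/-- A positive adapted summable majorant of the conditional root mean square errors. -/
noncomputable def errorBound {Ω E : Type*} [MeasurableSpace Ω] [NormedAddCommGroup E]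
    (P : Measure Ω) (F : ℕ → MeasurableSpace Ω) (a b : ℕ → Ω → E) (n : ℕ) (ω : Ω) : ℝ :=
  ((condLExp (F n) P (fun ω' => ‖a n ω'‖ₑ ^ 2) ω) ^ (1 / 2 : ℝ)).toReal +
    ((condLExp (F n) P (fun ω' => ‖b n ω'‖ₑ ^ 2) ω) ^ (1 / 2 : ℝ)).toReal + (1 / 2) ^ n

section ErrorBound

variable {Ω E : Type*} {mΩ : MeasurableSpace Ω} [NormedAddCommGroup E]
  {P : Measure Ω} {F : ℕ → MeasurableSpace Ω} {a b : ℕ → Ω → E}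

/-- The geometric term in `errorBound` serves this positivity: the bound is Young's parameter and
gets inverted, even where the errors vanish. -/
theorem errorBound_pos (n : ℕ) (ω : Ω) : 0 < errorBound P F a b n ω := by
  unfold errorBound
  positivity

theorem measurable_errorBound (n : ℕ) : Measurable[F n] (errorBound P F a b n) :=
  ((((measurable_condLExp (F n) P _).pow_const _).ennreal_toReal).add
    (((measurable_condLExp (F n) P _).pow_const _).ennreal_toReal)).add_const _

theorem summable_errorBound {ω : Ω} (ha : errorSum P F a ω < ∞) (hb : errorSum P F b ω < ∞) :
    Summable fun n => errorBound P F a b n ω :=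
  ((ENNReal.summable_toReal ha.ne).add (ENNReal.summable_toReal hb.ne)).add
    (summable_geometric_of_lt_one (by norm_num) (by norm_num))

/-- Finiteness of the sums excludes infinite terms, which `toReal` would send to `0`. -/
theorem condLExp_add_le_errorBound_sq {ω : Ω} (ha : errorSum P F a ω < ∞)
    (hb : errorSum P F b ω < ∞) (n : ℕ) :
    condLExp (F n) P (fun ω' => ‖a n ω'‖ₑ ^ 2) ω + condLExp (F n) P (fun ω' => ‖b n ω'‖ₑ ^ 2) ω ≤
      ENNReal.ofReal (errorBound P F a b n ω ^ 2) := by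
  have h1 := ENNReal.ne_top_of_tsum_ne_top ha.ne n
  have h2 := ENNReal.ne_top_of_tsum_ne_top hb.ne n
  have hsq : ∀ r : ℝ≥0∞, r ^ (1 / 2 : ℝ) ≠ ∞ →
      r = ENNReal.ofReal ((r ^ (1 / 2 : ℝ)).toReal ^ 2) := by
    intro r hr
    rw [ENNReal.ofReal_pow ENNReal.toReal_nonneg, ENNReal.ofReal_toReal hr, ← ENNReal.rpow_natCast,
      ← ENNReal.rpow_mul]
    norm_num
  rw [hsq _ h1, hsq _ h2, ← ENNReal.ofReal_add (by positivity) (by positivity)]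
  refine ENNReal.ofReal_le_ofReal ?_
  have h3 : (0 : ℝ) ≤ (1 / 2) ^ n := by positivity
  have h4 := ENNReal.toReal_nonneg (a := condLExp (F n) P (fun ω' => ‖a n ω'‖ₑ ^ 2) ω ^ (1 / 2 : ℝ))
  have h5 := ENNReal.toReal_nonneg (a := condLExp (F n) P (fun ω' => ‖b n ω'‖ₑ ^ 2) ω ^ (1 / 2 : ℝ))
  unfold errorBound
  nlinarith [mul_nonneg h4 h5, mul_nonneg h4 h3, mul_nonneg h5 h3]

end ErrorBound

theorem summable_sq_of_nonneg {f : ℕ → ℝ} (hf : Summable f) (h0 : ∀ n, 0 ≤ f n) :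
    Summable fun n => f n ^ 2 := by
  refine Summable.of_nonneg_of_le (fun n => sq_nonneg _) (fun n => ?_) (hf.mul_left (∑' n, f n))
  rw [sq]
  exact mul_le_mul_of_nonneg_right (hf.le_tsum n fun k _ => h0 k) (h0 n)

variable [∀ i, CompleteSpace (H i)] [∀ i, MeasurableSpace (H i)] [∀ i, BorelSpace (H i)]
  [∀ i, SecondCountableTopology (H i)] {Ω : Type*} {mΩ : MeasurableSpace Ω} {P : Measure Ω}

/-- Almost sure weak convergence of block-coordinate Krasnoselskii–Mann iterations with random
sweeping. -/
theorem ae_exists_weaklyTendsto_fixedPoint [IsProbabilityMeasure P] {ε : ℕ → Ω → Selection m}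
    (hε : ∀ n, Measurable (ε n)) {p : Fin m → ℝ} (hp0 : ∀ i, 0 < p i)
    (hp : ∀ n i, P.real {ω | (ε n ω).1 i = 1} = p i)
    {x e a b : ℕ → Ω → PiLp 2 H} (hxm : ∀ n, Measurable (x n)) (ha : ∀ n, Measurable (a n))
    (hb : ∀ n, Measurable (b n))
    (hind : ∀ n, Indep (MeasurableSpace.comap (ε n) inferInstance) (history x n) P)
    {T : PiLp 2 H → PiLp 2 H} (hT : IsFirmlyNonexpansive T) (hfix : ∃ y, T y = y)
    {μ : ℕ → ℝ} (hμ : ∀ n, μ n ∈ Set.Ioo (0 : ℝ) 2) {c : ℝ} (hc : 0 < c)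
    (hμc : ∀ n, c ≤ μ n * (2 - μ n)) {K : ℝ} (hK : 0 ≤ K)
    (he : ∀ n ω, ‖e n ω‖ ^ 2 ≤ K * (‖a n ω‖ ^ 2 + ‖b n ω‖ ^ 2))
    (hx : ∀ n ω i, x (n + 1) ω i = x n ω i +
      ((((ε n ω).1 i : ℕ) : ℝ) * μ n) • (T (x n ω) i + e n ω i - x n ω i))
    (ha_sum : ∀ᵐ ω ∂P, errorSum P (history x) a ω < ∞)
    (hb_sum : ∀ᵐ ω ∂P, errorSum P (history x) b ω < ∞) :
    ∀ᵐ ω ∂P, ∃ y, T y = y ∧ WeaklyTendsto (fun n => x n ω) y := by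
  have hp1 : ∀ i, p i ≤ 1 := fun i => hp 0 i ▸ measureReal_le_one
  have hw1 : ∀ i, 1 ≤ (p i)⁻¹ := fun i => (one_le_inv₀ (hp0 i)).2 (hp1 i)
  have hw : ∀ i, 0 ≤ (p i)⁻¹ := fun i => (inv_pos.2 (hp0 i)).le
  have hW : 0 ≤ ∑ i, (p i)⁻¹ := Finset.sum_nonneg fun i _ => hw i
  have hTc : Continuous T := hT.continuous
  set w : Fin m → ℝ := fun i => (p i)⁻¹ with hwdef
  set α := errorBound P (history x) a b with hα
  have hα0 : ∀ n ω, 0 < α n ω := errorBound_pos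
  have hαs : ∀ᵐ ω ∂P, Summable fun n => α n ω := by
    filter_upwards [ha_sum, hb_sum] with ω h1 h2 using summable_errorBound h1 h2
  have hRS : ∀ y, T y = y → ∀ᵐ ω ∂P,
      (∃ l, Tendsto (fun n => weightedNormSq w (x n ω - y)) atTop (𝓝 l)) ∧
        Summable fun n => μ n * (2 - μ n) * ‖T (x n ω) - x n ω‖ ^ 2 := by
    intro y hy
    have hxF : ∀ n, Measurable[history x n] (x n) := measurable_history x
    have hαF : ∀ n, Measurable[history x n] (α n) := measurable_errorBound
    refine robbinsSiegmund (historyFiltration hxm)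
      (ξ := fun n ω => weightedNormSq w (x n ω - y))
      (η := fun n ω => μ n * (2 - μ n) * ‖T (x n ω) - x n ω‖ ^ 2) (χ := α)
      (β := fun n ω => 4 * (∑ i, (p i)⁻¹) * K * (α n ω ^ 2 + α n ω))
      (fun n ω => weightedNormSq_nonneg hw _)
      (fun n ω => mul_nonneg (hc.le.trans (hμc n)) (sq_nonneg _)) (fun n ω => (hα0 n ω).le)
      (fun n ω => by have := (hα0 n ω).le; positivity) (fun n => ?_) (fun n => ?_) hαF
      (fun n => ?_) (fun n g hg => ?_) hαs ?_
    · exact (show Continuous fun z => weightedNormSq w (z - y) from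
        (continuous_weightedNormSq w).comp (by fun_prop)).measurable.comp (hxF n)
    · exact (show Continuous fun z => μ n * (2 - μ n) * ‖T z - z‖ ^ 2 by
        fun_prop).measurable.comp (hxF n)
    · exact (show Continuous fun t : ℝ => 4 * (∑ i, (p i)⁻¹) * K * (t ^ 2 + t) by
        fun_prop).measurable.comp (hαF n)
    · refine lintegral_step_le (F := history x n) ((historyFiltration hxm).le n) (hε n) (hind n)
        hp0 (hp n) (hxF n) (ha n) (hb n) hT hy (hμ n) hK (he n) (hx n) (hαF n) (hα0 n) ?_ hg
      filter_upwards [ha_sum, hb_sum] with ω h1 h2 using condLExp_add_le_errorBound_sq h1 h2 n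
    · filter_upwards [hαs] with ω hω
      exact ((summable_sq_of_nonneg hω fun n => (hα0 n ω).le).add hω).mul_left _
  obtain ⟨y₀, hy₀⟩ := hfix
  -- The null set in `hRS` depends on `y`; a countable dense set of fixed points gives a common one.
  obtain ⟨D, hDsub, hDc, hD⟩ := (TopologicalSpace.IsSeparable.of_separableSpace
    {y | T y = y}).exists_countable_dense_subset
  have hall : ∀ᵐ ω ∂P, ∀ d ∈ D,
      ∃ l, Tendsto (fun n => weightedNormSq w (x n ω - d)) atTop (𝓝 l) :=
    (ae_ball_iff hDc).2 fun d hd => (hRS d (hDsub hd)).mono fun ω h => h.1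
  filter_upwards [hall, hRS y₀ hy₀] with ω hω ⟨⟨l₀, hl₀⟩, hsum⟩
  obtain ⟨M, hM⟩ := hl₀.bddAbove_range
  have hbd : ∀ n, ‖x n ω‖ ≤ √M + ‖y₀‖ := by
    intro n
    have h1 : ‖x n ω - y₀‖ ≤ √M :=
      Real.le_sqrt_of_sq_le ((norm_sq_le_weightedNormSq hw1 _).trans (hM ⟨n, rfl⟩))
    calc ‖x n ω‖ = ‖(x n ω - y₀) + y₀‖ := by rw [sub_add_cancel]
      _ ≤ ‖x n ω - y₀‖ + ‖y₀‖ := norm_add_le _ _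
      _ ≤ _ := by gcongr
  have hTx : Tendsto (fun n => ‖T (x n ω) - x n ω‖) atTop (𝓝 0) := by
    have h1 : Summable fun n => ‖T (x n ω) - x n ω‖ ^ 2 := by
      refine Summable.of_nonneg_of_le (fun n => sq_nonneg _) (fun n => ?_) (hsum.mul_left c⁻¹)
      rw [← div_eq_inv_mul, le_div_iff₀ hc, mul_comm]
      exact mul_le_mul_of_nonneg_right (hμc n) (sq_nonneg _)
    have h2 := h1.tendsto_atTop_zero.sqrt
    simpa using h2
  refine exists_weaklyTendsto_fixedPoint (fun x y => hT.norm_sub_le x y) hbd hTx (diagCLM w) ?_ hD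
    ?_
  · intro u hu
    rw [inner_diagCLM_self] at hu
    have h1 := norm_sq_le_weightedNormSq hw1 u
    rw [hu] at h1
    exact norm_eq_zero.1 (pow_eq_zero_iff two_ne_zero |>.1 (le_antisymm h1 (sq_nonneg _)))
  · intro d hd d' hd'
    obtain ⟨l, hl⟩ := hω d hd
    obtain ⟨l', hl'⟩ := hω d' hd'
    refine ⟨_, (((hl.sub hl').const_sub
      (weightedNormSq w d - weightedNormSq w d')).div_const 2).congr fun n => ?_⟩
    rw [weightedNormSq_sub_sub_weightedNormSq_sub]
    ring

end KrasnoselskiiMann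

/-! ### Measurability of the weak limit -/

section MeasurableLimit

theorem exists_measurable_weakLimit {E Ω : Type*} [NormedAddCommGroup E] [InnerProductSpace ℝ E]
    [CompleteSpace E] [TopologicalSpace.SeparableSpace E] [MeasurableSpace E] [BorelSpace E]
    [MeasurableSpace Ω] {P : Measure Ω} {x : ℕ → Ω → E} (hx : ∀ n, Measurable (x n)) {S : Set E}
    (hS : S.Nonempty) (h : ∀ᵐ ω ∂P, ∃ y ∈ S, WeaklyTendsto (fun n => x n ω) y) :
    ∃ f : Ω → E, Measurable f ∧ (∀ ω, f ω ∈ S) ∧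
      ∀ᵐ ω ∂P, WeaklyTendsto (fun n => x n ω) (f ω) := by
  classical
  obtain ⟨y₀, hy₀⟩ := hS
  obtain ⟨G, hGsub, hGm, hG⟩ := exists_measurable_superset_of_null (ae_iff.1 h)
  have hlim : ∀ ω, ω ∉ G → ∃ y ∈ S, WeaklyTendsto (fun n => x n ω) y := fun ω hω => by
    by_contra hn
    exact hω (hGsub hn)
  -- This choice is measurable off `G` since its inner products are limits of measurable functions;
  -- the constant `y₀` on the null set `G` keeps membership in `S` valid everywhere.
  choose! f hfS hf using hlim
  refine ⟨fun ω => if ω ∈ G then y₀ else f ω, ?_, fun ω => ?_, ?_⟩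
  · refine measurable_of_forall_inner fun v => ?_
    refine measurable_of_tendsto_metrizable
      (f := fun n ω => if ω ∈ G then inner ℝ v y₀ else inner ℝ v (x n ω)) (fun n => ?_) ?_
    · have hinner : Measurable fun y : E => (inner ℝ v y : ℝ) :=
        (show Continuous fun y : E => (inner ℝ v y : ℝ) by fun_prop).measurable
      exact Measurable.ite hGm measurable_const (hinner.comp (hx n))
    · refine tendsto_pi_nhds.2 fun ω => ?_
      by_cases hω : ω ∈ G
      · simp [hω]
      · simpa [hω] using (weaklyTendsto_iff_inner _ _).1 (hf ω hω) v
  · by_cases hω : ω ∈ G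
    · simpa [hω] using hy₀
    · simpa [hω] using hfS ω hω
  · filter_upwards [measure_eq_zero_iff_ae_notMem.1 hG] with ω hω
    simpa [hω] using hf ω hω

end MeasurableLimit

/-! ### Infinitely many activations and frozen blocks -/

section Refresh

/-- A sequence that is refreshed infinitely often with the current term of a convergent sequence,
and kept constant otherwise, converges to the same limit. -/
theorem tendsto_of_frequently_refresh {X : Type*} {l : Filter X} {z q : ℕ → X} {s : ℕ → Prop}
    (h1 : ∀ n, s n → z (n + 1) = q n) (h0 : ∀ n, ¬s n → z (n + 1) = z n)
    (hs : ∃ᶠ n in atTop, s n) (hq : Tendsto q atTop l) : Tendsto z atTop l := by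
  intro U hU
  obtain ⟨N, hN⟩ := eventually_atTop.1 (hq hU)
  -- After one refresh at a time `k ≥ N`, later values are either refreshed inside `U` or unchanged,
  -- so they never leave `U`.
  obtain ⟨k, hkN, hk⟩ := frequently_atTop.1 hs N
  refine mem_map.2 (mem_atTop_sets.2 ⟨k + 1, fun n hn => ?_⟩)
  induction n, hn using Nat.le_induction with
  | base => simpa [h1 k hk] using hN k hkN
  | succ n hn ih =>
    by_cases hsn : s n
    · simpa [h1 n hsn] using hN n (by omega)
    · simpa [h0 n hsn] using ih

variable {m : ℕ} {H : Fin m → Type*} [∀ i, NormedAddCommGroup (H i)]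
  [∀ i, InnerProductSpace ℝ (H i)]

/-- Blocks are refreshed at different times, so weak convergence of `z` must be tested block by
block. -/
theorem weaklyTendsto_pi_iff [∀ i, CompleteSpace (H i)] {x : ℕ → PiLp 2 H} {l : PiLp 2 H} :
    WeaklyTendsto x l ↔
      ∀ i, ∀ v : H i, Tendsto (fun n => (inner ℝ v (x n i) : ℝ)) atTop (𝓝 (inner ℝ v (l i))) := by
  rw [weaklyTendsto_iff_inner]
  constructor
  · intro h i v
    have key : ∀ y : PiLp 2 H,
        (inner ℝ (WithLp.toLp 2 (Pi.single i v) : PiLp 2 H) y : ℝ) = inner ℝ v (y i) := by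
      intro y
      rw [PiLp.inner_apply, Finset.sum_eq_single i]
      · simp
      · intro j _ hj
        simp [Pi.single_eq_of_ne hj]
      · simp
    simpa only [key] using h (WithLp.toLp 2 (Pi.single i v))
  · intro h v
    simp only [PiLp.inner_apply]
    exact tendsto_finsetSum _ fun i _ => h i (v i)

theorem WeaklyTendsto.add {E : Type*} [NormedAddCommGroup E] [InnerProductSpace ℝ E]
    [CompleteSpace E] {x y : ℕ → E} {k l : E} (hx : WeaklyTendsto x k) (hy : WeaklyTendsto y l) :
    WeaklyTendsto (fun n => x n + y n) (k + l) := by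
  rw [weaklyTendsto_iff_inner] at *
  intro v
  simpa only [inner_add_right] using (hx v).add (hy v)

theorem WeaklyTendsto.const_smul_sub {E : Type*} [NormedAddCommGroup E] [InnerProductSpace ℝ E]
    [CompleteSpace E] {x y : ℕ → E} {k l : E} (c : ℝ) (hx : WeaklyTendsto x k)
    (hy : WeaklyTendsto y l) : WeaklyTendsto (fun n => c • (x n - y n)) (c • (k - l)) := by
  rw [weaklyTendsto_iff_inner] at *
  intro v
  simpa only [inner_smul_right, inner_sub_right] using ((hx v).sub (hy v)).const_mul c

/-- The second Borel–Cantelli lemma: a constant nonzero probability has a divergent sum. -/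
theorem ae_frequently_of_iIndepFun {Ω β : Type*} [MeasurableSpace Ω] [MeasurableSpace β]
    {P : Measure Ω} {f : ℕ → Ω → β} (hf : ∀ n, Measurable (f n)) (hind : iIndepFun f P)
    {s : Set β} (hs : MeasurableSet s) {c : ℝ≥0∞} (hc : c ≠ 0) (hcs : ∀ n, P (f n ⁻¹' s) = c) :
    ∀ᵐ ω ∂P, ∃ᶠ n in atTop, f n ω ∈ s := by
  have : IsProbabilityMeasure P := hind.isProbabilityMeasure
  have hm : ∀ n, MeasurableSet (f n ⁻¹' s) := fun n => hf n hs
  have hI : iIndepSet (fun n => f n ⁻¹' s) P := by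
    refine (iIndepSet_iff_meas_biInter hm).2 fun S => ?_
    exact hind.measure_inter_preimage_eq_mul S fun _ _ => hs
  have h1 := measure_limsup_eq_one hm hI (by
    simp only [hcs]
    exact ENNReal.tsum_const_eq_top_of_ne_zero hc)
  have h2 : MeasurableSet (limsup (fun n => f n ⁻¹' s) atTop) :=
    MeasurableSet.measurableSet_limsup hm
  filter_upwards [(prob_compl_eq_zero_iff h2).2 h1] with ω hω
  exact mem_limsup_iff_frequently_mem.1 hω

end Refresh

/-! ### Measurability of the iterates -/

section Measurability

variable {m : ℕ} {H : Fin m → Type*} [∀ i, NormedAddCommGroup (H i)]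
  [∀ i, MeasurableSpace (H i)] [∀ i, BorelSpace (H i)]
  [∀ i, SecondCountableTopology (H i)] {Ω : Type*} [MeasurableSpace Ω]

theorem measurable_piLp_iff {f : Ω → PiLp 2 H} :
    Measurable f ↔ ∀ i, Measurable fun ω => f ω i := by
  constructor
  · intro hf i
    exact (show Continuous fun y : PiLp 2 H => y i by fun_prop).measurable.comp hf
  · intro hf
    exact (WithLp.measurable_toLp 2 _).comp (measurable_pi_lambda _ hf)

variable [∀ i, InnerProductSpace ℝ (H i)]

theorem measurable_drIterates {x z a b : ℕ → Ω → PiLp 2 H} {ε : ℕ → Ω → Selection m}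
    {Q : PiLp 2 H → PiLp 2 H} (hQ : Continuous Q) {J : ∀ i, H i → H i}
    (hJ : ∀ i, Continuous (J i)) {μ : ℕ → ℝ} (hx₀ : Measurable (x 0)) (hz₀ : Measurable (z 0))
    (ha : ∀ n, Measurable (a n)) (hb : ∀ n, Measurable (b n)) (hε : ∀ n, Measurable (ε n))
    (hz : ∀ n ω i, z (n + 1) ω i = z n ω i + (((ε n ω).1 i : ℕ) : ℝ) •
      (Q (x n ω) i + b n ω i - z n ω i))
    (hx : ∀ n ω i, x (n + 1) ω i = x n ω i + ((((ε n ω).1 i : ℕ) : ℝ) * μ n) •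
      (J i ((2 : ℝ) • z (n + 1) ω i - x n ω i) + a n ω i - z (n + 1) ω i)) (n : ℕ) :
    Measurable (x n) ∧ Measurable (z n) := by
  induction n with
  | zero => exact ⟨hx₀, hz₀⟩
  | succ n ih =>
    have hεi : ∀ i, Measurable fun ω => (((ε n ω).1 i : ℕ) : ℝ) := fun i =>
      (Measurable.of_discrete (f := fun s : Selection m => ((s.1 i : ℕ) : ℝ))).comp (hε n)
    have hxn := measurable_piLp_iff.1 ih.1
    have hzn := measurable_piLp_iff.1 ih.2
    have hQn := measurable_piLp_iff.1 (hQ.measurable.comp ih.1)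
    have hz' : ∀ i, Measurable fun ω => z (n + 1) ω i := fun i => by
      simp only [hz]
      exact (hzn i).add ((hεi i).smul (((hQn i).add (measurable_piLp_iff.1 (hb n) i)).sub (hzn i)))
    refine ⟨measurable_piLp_iff.2 fun i => ?_, measurable_piLp_iff.2 hz'⟩
    simp only [hx]
    have hJi := (hJ i).measurable.comp (((hz' i).const_smul (2 : ℝ)).sub (hxn i))
    exact (hxn i).add (((hεi i).mul_const _).smul
      ((hJi.add (measurable_piLp_iff.1 (ha n) i)).sub (hz' i)))

end Measurability

end BlockDR

/-! ### The convergence theorem -/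

theorem proposition5p1
    {m : ℕ} {H : Fin m → Type*}
    [∀ i, NormedAddCommGroup (H i)] [∀ i, InnerProductSpace ℝ (H i)]
    [∀ i, CompleteSpace (H i)] [∀ i, TopologicalSpace.SeparableSpace (H i)]
    [∀ i, MeasurableSpace (H i)] [∀ i, BorelSpace (H i)]
    {Ω : Type*} [MeasurableSpace Ω] (P : Measure Ω) [IsProbabilityMeasure P]
    (A : ∀ i, H i → Set (H i)) (hA : ∀ i, IsMaximallyMonotone (A i))
    (B : PiLp 2 H → Set (PiLp 2 H)) (hB : IsMaximallyMonotone B)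
    (hF : (primalSolutions A B).Nonempty)
    (γ : ℝ) (hγ : 0 < γ)
    (μ : ℕ → ℝ) (hμ : ∀ n, μ n ∈ Set.Ioo (0 : ℝ) 2)
    (hμ_inf : 0 < ⨅ n, μ n) (hμ_sup : ⨆ n, μ n < 2)
    (x z a b : ℕ → Ω → PiLp 2 H)
    (hx₀ : Measurable (x 0)) (hz₀ : Measurable (z 0))
    (ha : ∀ n, Measurable (a n)) (hb : ∀ n, Measurable (b n))
    (ε : ℕ → Ω → Selection m) (hε : ∀ n, Measurable (ε n))
    (hε_id : ∀ n, IdentDistrib (ε n) (ε 0) P P)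
    (hz : ∀ n ω i, z (n + 1) ω i = z n ω i + (((ε n ω).1 i : ℕ) : ℝ) •
      (resolventMap (fun y => γ • B y) (x n ω) i + b n ω i - z n ω i))
    (hx : ∀ n ω i, x (n + 1) ω i = x n ω i + ((((ε n ω).1 i : ℕ) : ℝ) * μ n) •
      (resolventMap (fun y => γ • A i y) ((2 : ℝ) • z (n + 1) ω i - x n ω i) + a n ω i
        - z (n + 1) ω i))
    (ha_sum : ∀ᵐ ω ∂P, errorSum P (history x) a ω < ∞)
    (hb_sum : ∀ᵐ ω ∂P, errorSum P (history x) b ω < ∞)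
    (h_indep : ∀ n, Indep (MeasurableSpace.comap (ε n) inferInstance) (history x n) P)
    (hp : ∀ i, 0 < P {ω | (ε 0 ω).1 i = 1}) :
    ∃ xlim zlim ulim : Ω → PiLp 2 H,
      Measurable xlim ∧ Measurable zlim ∧ Measurable ulim ∧
      (∀ ω, zlim ω = resolventMap (fun y => γ • B y) (xlim ω)) ∧
      (∀ ω, ulim ω = γ⁻¹ • (xlim ω - zlim ω)) ∧
      (∀ᵐ ω ∂P, WeaklyTendsto (fun n => x n ω) (xlim ω)) ∧
      (∀ ω, zlim ω ∈ primalSolutions A B) ∧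
      (∀ ω, ulim ω ∈ dualSolutions A B) ∧
      (iIndepFun ε P →
        IsWeaklySeqContinuous (resolventMap (fun y => γ • B y)) →
        (∀ᵐ ω ∂P, WeaklyTendsto (fun n => b n ω) 0) →
        (∀ᵐ ω ∂P, WeaklyTendsto (fun n => z n ω) (zlim ω)) ∧
        (∀ᵐ ω ∂P, WeaklyTendsto (fun n => γ⁻¹ • (x n ω - z n ω)) (ulim ω))) := by

  have : ∀ i, SecondCountableTopology (H i) := fun i => UniformSpace.secondCountable_of_separable _
  set Q : PiLp 2 H → PiLp 2 H := resolventMap fun y => γ • B y with hQdef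
  set J : ∀ i, H i → H i := fun i => resolventMap fun y => γ • A i y with hJdef
  have hQ : IsFirmlyNonexpansive Q := hB.isFirmlyNonexpansive_resolventMap hγ
  have hJ : ∀ i, IsFirmlyNonexpansive (J i) := fun i =>
    (hA i).isFirmlyNonexpansive_resolventMap hγ
  have hJb : IsFirmlyNonexpansive (blockMap J) := isFirmlyNonexpansive_blockMap hJ
  have hT : IsFirmlyNonexpansive (drOp (blockMap J) Q) := hJb.drOp hQ
  have hmeas := measurable_drIterates hQ.continuous (fun i => (hJ i).continuous) hx₀ hz₀ ha hb hε
    hz hx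
  have hsel : ∀ i, MeasurableSet {s : Selection m | s.1 i = 1} := fun i => MeasurableSet.of_discrete
  have hpn : ∀ n i, P {ω | (ε n ω).1 i = 1} = P {ω | (ε 0 ω).1 i = 1} := fun n i =>
    (hε_id n).measure_mem_eq (hsel i)
  have hfix := exists_drOp_eq_self hA hB hγ hF
  have hμ_bdd : BddBelow (Set.range μ) := ⟨0, by rintro _ ⟨n, rfl⟩; exact (hμ n).1.le⟩
  have hμ_bdd' : BddAbove (Set.range μ) := ⟨2, by rintro _ ⟨n, rfl⟩; exact (hμ n).2.le⟩
  have hμc : ∀ n, (⨅ n, μ n) * (2 - ⨆ n, μ n) ≤ μ n * (2 - μ n) := fun n =>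
    mul_le_mul (ciInf_le hμ_bdd n) (sub_le_sub_left (le_ciSup hμ_bdd' n) 2)
      (sub_nonneg.2 hμ_sup.le) (hμ n).1.le
  have hconv := ae_exists_weaklyTendsto_fixedPoint (P := P) hε
    (p := fun i => P.real {ω | (ε 0 ω).1 i = 1})
    (fun i => ENNReal.toReal_pos (hp i).ne' (measure_ne_top _ _))
    (fun n i => congrArg ENNReal.toReal (hpn n i)) (fun n => (hmeas n).1) ha hb h_indep hT hfix hμ
    (mul_pos hμ_inf (sub_pos.2 hμ_sup)) hμc (K := 18) (by norm_num)
    -- The effective error of one step of `T` with `z = Q x + b`. Nonexpansiveness gives `‖e‖ ≤ 3‖b‖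
    -- + ‖a‖`, whose square is at most `18‖b‖² + 2‖a‖²`, hence `K = 18`.
    (e := fun n ω => blockMap J ((2 : ℝ) • (Q (x n ω) + b n ω) - x n ω) -
      blockMap J ((2 : ℝ) • Q (x n ω) - x n ω) + a n ω - b n ω)
    (fun n ω => by
      have h1 := hJb.norm_sub_le ((2 : ℝ) • (Q (x n ω) + b n ω) - x n ω)
        ((2 : ℝ) • Q (x n ω) - x n ω)
      have e1 : (2 : ℝ) • (Q (x n ω) + b n ω) - x n ω - ((2 : ℝ) • Q (x n ω) - x n ω) =
          (2 : ℝ) • b n ω := by module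
      rw [e1, norm_smul, Real.norm_two] at h1
      set d := blockMap J ((2 : ℝ) • (Q (x n ω) + b n ω) - x n ω) -
        blockMap J ((2 : ℝ) • Q (x n ω) - x n ω)
      have h2 : ‖d + a n ω - b n ω‖ ≤ 3 * ‖b n ω‖ + ‖a n ω‖ := by
        have h3 := norm_sub_le (d + a n ω) (b n ω)
        have h4 := norm_add_le d (a n ω)
        linarith
      have h5 : ‖d + a n ω - b n ω‖ ^ 2 ≤ (3 * ‖b n ω‖ + ‖a n ω‖) ^ 2 := by gcongr
      nlinarith [sq_nonneg (3 * ‖b n ω‖ - ‖a n ω‖), sq_nonneg ‖a n ω‖])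
    (fun n ω i => by
      rw [hx]
      -- The recursions match because the old `z` matters only in inactive blocks, where the
      -- increment of `x` vanishes.
      rcases fin_two_eq_one_or_eq_zero ((ε n ω).1 i) with h | h
      · have hz1 : z (n + 1) ω i = Q (x n ω) i + b n ω i := by
          rw [hz, h, Fin.val_one, Nat.cast_one, one_smul]
          abel
        congr 2
        simp only [hz1, drOp, PiLp.add_apply, PiLp.sub_apply, PiLp.smul_apply, blockMap_apply]
        abel
      · simp [h])
    ha_sum hb_sum
  obtain ⟨xlim, hxlm, hxfix, hxlim⟩ := exists_measurable_weakLimit (fun n => (hmeas n).1)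
    (S := {y | drOp (blockMap J) Q y = y}) hfix hconv
  have hQm : Measurable fun ω => Q (xlim ω) := hQ.continuous.measurable.comp hxlm
  refine ⟨xlim, fun ω => Q (xlim ω), fun ω => γ⁻¹ • (xlim ω - Q (xlim ω)), hxlm, hQm,
    (show Measurable fun ω => xlim ω - Q (xlim ω) from hxlm.sub hQm).const_smul γ⁻¹,
    fun ω => rfl, fun ω => rfl, hxlim,
    fun ω => resolventMap_mem_primalSolutions hA hB hγ (hxfix ω),
    fun ω => smul_sub_resolventMap_mem_dualSolutions hA hB hγ (hxfix ω), fun hind hQw hbw => ?_⟩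
  have hfreq : ∀ᵐ ω ∂P, ∀ i, ∃ᶠ n in atTop, (ε n ω).1 i = 1 :=
    ae_all_iff.2 fun i => ae_frequently_of_iIndepFun hε hind (hsel i) (hp i).ne' fun n => hpn n i
  have hzlim : ∀ᵐ ω ∂P, WeaklyTendsto (fun n => z n ω) (Q (xlim ω)) := by
    filter_upwards [hfreq, hxlim, hbw] with ω hω hxω hbω
    -- `Q xₙ + bₙ` is the value copied into the active blocks of `z`.
    have hq := (hQw _ _ hxω).add hbω
    rw [add_zero] at hq
    refine weaklyTendsto_pi_iff.2 fun i v => ?_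
    refine tendsto_of_frequently_refresh (fun n h => ?_) (fun n h => ?_) (hω i)
      (weaklyTendsto_pi_iff.1 hq i v)
    · rw [hz, h, Fin.val_one, Nat.cast_one, one_smul, add_sub_cancel, PiLp.add_apply]
    · rw [hz, (fin_two_eq_one_or_eq_zero _).resolve_left h]
      simp
  refine ⟨hzlim, ?_⟩
  filter_upwards [hxlim, hzlim] with ω h1 h2 using h1.const_smul_sub _ h2
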